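/- Let $E$ be a complex Banach lattice, i.e. the complexification $E = E_{\mathbb R} + iE_{\mathbb R}$ of a real Banach lattice $E_{\mathbb R}$, with modulus $|x+iy| = \sup_{\theta}(x\cos\theta + y\sin\theta)$, norm $\|z\| = \|\,|z|\,\|$ and positive cone $E_+ = \{x \in E_{\mathbb R} : x \ge 0\}$; write $f>0$ if $f\in E_+\setminus\{0\}$. For $u \in E_+$ let $E_u = \{f \in E : |f| \le cu \text{ for some } c \ge 0\}$; $u$ is called a quasi-interior point of $E_+$, written $u \gg 0$, if $E_u$ is dense in $E$. A bounded operator $T$ on $E$ is positive if $TE_+ \subseteq E_+$; it is irreducible if $\{0\}$ and $E$ are the only closed $T$-invariant ideals of $E$ (an ideal is a linear subspace $J$ such that $|f| \le |g|$ and $g \in J$ imply $f\in J$); and $T \gg 0$ means that $Tf \gg 0$ for every $f > 0$. A functional $\varphi \in E'$ is strictly positive if $\langle\varphi, f\rangle > 0$ for every $f>0$. A linear operator $A : D(A)\subseteq E \to E$ is real if $D(A) = (D(A)\cap E_{\mathbb R}) + i(D(A) \cap E_{\mathbb R})$ and $A(D(A)\cap E_{\mathbb R}) \subseteq E_{\mathbb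 R}$. An eigenvalue $\lambda$ of $A$ is geometrically simple if $\dim \ker(\lambda - A) = 1$, and algebraically simple if $\dim \bigcup_{n}\ker((\lambda-A)^n) = 1$. **Proposition.** Let $A$ be a closed, densely defined and real operator on a complex Banach lattice $E$, with adjoint $A'$ on the dual $E'$. Let $\lambda_0 \in \mathbb R$ be an eigenvalue of $A$ and a pole of the resolvent $R(\,\cdot\,,A) = (\,\cdot\, - A)^{-1}$, and let $P = \frac{1}{2\pi i}\oint_{|z-\lambda_0| = r} R(z,A)\,dz$ ($r>0$ small) be the corresponding spectral projection. Then the following assertions are equivalent. (i) $P$ is positive and irreducible. (ii) $P \gg 0$. (iii) The eigenvalue $\lambda_0$ of $A$ is geometrically simple, $\ker(\lambda_0 - A)$ contains a quasi-interior point of $E_+$, and $\ker(\lambda_0 - A')$ contains a strictly positive functional. (iv) The eigenvalue $\lambda_0$ of $A$ is algebraically simple, $\ker(\lambda_0 - A)$ contains a quasi-interior point of $E_+$, and $\operatorname{im}(\lambda_0 - A) \cap E_+ = \{0\}$. If these assertions hold, then $\lambda_0$ is a simple pole (a pole of order one) of both resolvents $R(\,\cdot\,,A)$ and $R(\,\cdot\,,A')$,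 and $\lambda_0$ is the only eigenvalue $\lambda \in \mathbb C$ of $A$ that has a positive eigenvector (an eigenvector in $E_+$). -/

import Mathlib

open Filter Topology

noncomputable section

namespace StrongProjections

/-! ### The modulus in the complexification of a real Banach lattice -/

section Modulus

variable {X : Type*} [NormedAddCommGroup X] [Lattice X]
  [IsOrderedAddMonoid X] [NormedSpace ℝ X] [IsOrderedModule ℝ X]

theorem exists_finite_trig_net {ε : ℝ} (hε : 0 < ε) :
    ∃ T : Finset ℝ, T.Nonempty ∧ ∀ θ : ℝ, ∃ t ∈ T,
      |Real.cos θ - Real.cos t| ≤ ε ∧ |Real.sin θ - Real.sin t| ≤ ε := by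
  classical
  set S : Set (ℝ × ℝ) := Set.range fun θ : ℝ => (Real.cos θ, Real.sin θ) with hS
  have hsub : S ⊆ Metric.closedBall (0 : ℝ × ℝ) 1 := by
    rintro _ ⟨θ, rfl⟩
    rw [mem_closedBall_zero_iff, Prod.norm_def]
    exact max_le (Real.abs_cos_le_one θ) (Real.abs_sin_le_one θ)
  have htb : TotallyBounded S := (isCompact_closedBall (0 : ℝ × ℝ) 1).totallyBounded.subset hsub
  obtain ⟨t, htS, htf, hcov⟩ := Metric.finite_approx_of_totallyBounded htb ε hε
  have hch : ∀ p : ℝ × ℝ, ∃ θ : ℝ, p ∈ t → (Real.cos θ, Real.sin θ) = p := by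
    intro p
    by_cases hp : p ∈ t
    · obtain ⟨θ, hθ⟩ := htS hp
      exact ⟨θ, fun _ => hθ⟩
    · exact ⟨0, fun h => absurd h hp⟩
  choose g hg using hch
  have key : ∀ θ : ℝ, ∃ s ∈ htf.toFinset.image g,
      |Real.cos θ - Real.cos s| ≤ ε ∧ |Real.sin θ - Real.sin s| ≤ ε := by
    intro θ
    have hmem : (Real.cos θ, Real.sin θ) ∈ S := ⟨θ, rfl⟩
    obtain ⟨p, hp, hd⟩ := Set.mem_iUnion₂.1 (hcov hmem)
    refine ⟨g p, Finset.mem_image_of_mem g (htf.mem_toFinset.2 hp), ?_⟩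
    rw [← hg p hp, Metric.mem_ball, Prod.dist_eq, max_lt_iff] at hd
    exact ⟨hd.1.le, hd.2.le⟩
  obtain ⟨s, hs, -⟩ := key 0
  exact ⟨_, ⟨s, hs⟩, key⟩

theorem smul_le_smul_abs {a ε : ℝ} (h : |a| ≤ ε) (x : X) : a • x ≤ ε • |x| := by
  have h0 : (0 : X) ≤ |x| := abs_nonneg x
  have h2 : |a| • |x| ≤ ε • |x| := smul_le_smul_of_nonneg_right h h0
  refine le_trans ?_ h2
  rcases le_total 0 a with ha | ha
  · rw [abs_of_nonneg ha]
    exact smul_le_smul_of_nonneg_left (le_abs_self x) ha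
  · rw [abs_of_nonpos ha]
    have : (-a) • (-x) ≤ (-a) • |x| :=
      smul_le_smul_of_nonneg_left (neg_le_abs x) (neg_nonneg.2 ha)
    simpa using this

variable [HasSolidNorm X]

/-- In a real Banach lattice the supremum `sup_θ (cos θ • x + sin θ • y)` always exists. -/
theorem exists_isLUB_modulus [CompleteSpace X] (x y : X) :
    ∃ m : X, IsLUB (Set.range fun θ : ℝ => Real.cos θ • x + Real.sin θ • y) m := by
  set s : ℝ → X := fun θ => Real.cos θ • x + Real.sin θ • y with hs
  set u : X := |x| + |y| with hu
  have hu0 : 0 ≤ u := add_nonneg (abs_nonneg x) (abs_nonneg y)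
  set δ : ℕ → ℝ := fun n => 1 / ((n : ℝ) + 1) with hδ
  have hδ0 : ∀ n, 0 < δ n := fun n => Nat.one_div_pos_of_nat
  choose T hTne hT using fun n => exists_finite_trig_net (hδ0 n)
  set a : ℕ → X := fun n => (T n).sup' (hTne n) s with ha
  have h1 : ∀ n θ, s θ ≤ a n + δ n • u := by
    intro n θ
    obtain ⟨t, ht, hc, hsn⟩ := hT n θ
    have e : s θ = s t + ((Real.cos θ - Real.cos t) • x + (Real.sin θ - Real.sin t) • y) := by
      simp only [hs, sub_smul]; abel
    rw [e, hu, smul_add]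
    exact add_le_add (Finset.le_sup' s ht) (add_le_add (smul_le_smul_abs hc x)
      (smul_le_smul_abs hsn y))
  have h2 : ∀ n m, a n ≤ a m + δ m • u := fun n m => Finset.sup'_le _ _ fun t _ => h1 m t
  have h3 : ∀ n m, ‖a n - a m‖ ≤ (δ n + δ m) * ‖u‖ := by
    intro n m
    have hsm : ∀ k, 0 ≤ δ k • u := fun k => smul_nonneg (hδ0 k).le hu0
    have hle : |a n - a m| ≤ (δ n + δ m) • u := by
      rw [add_smul]
      refine abs_le'.2 ⟨?_, ?_⟩
      · exact (sub_le_iff_le_add'.2 (h2 n m)).trans (le_add_of_nonneg_left (hsm n))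
      · rw [neg_sub]
        exact (sub_le_iff_le_add'.2 (h2 m n)).trans (le_add_of_nonneg_right (hsm m))
    have hpos : 0 ≤ δ n + δ m := add_nonneg (hδ0 n).le (hδ0 m).le
    have := norm_le_norm_of_abs_le_abs (hle.trans (le_abs_self _))
    rwa [norm_smul, Real.norm_of_nonneg hpos] at this
  have hδlim : Tendsto δ atTop (𝓝 0) := tendsto_one_div_add_atTop_nhds_zero_nat
  have hcau : CauchySeq a := by
    refine cauchySeq_of_le_tendsto_0 (fun N => (δ N + δ N) * ‖u‖) ?_ ?_
    · intro n m N hn hm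
      rw [dist_eq_norm]
      refine (h3 n m).trans (mul_le_mul_of_nonneg_right ?_ (norm_nonneg u))
      exact add_le_add (Nat.one_div_le_one_div hn) (Nat.one_div_le_one_div hm)
    · simpa using (hδlim.add hδlim).mul_const ‖u‖
  obtain ⟨l, hl⟩ := cauchySeq_tendsto_of_complete hcau
  refine ⟨l, ?_, ?_⟩
  · rintro _ ⟨θ, rfl⟩
    have : Tendsto (fun n => a n + δ n • u) atTop (𝓝 l) := by
      simpa using hl.add (hδlim.smul_const u)
    exact ge_of_tendsto' this fun n => h1 n θ
  · intro b hb
    exact le_of_tendsto' hl fun n => Finset.sup'_le _ _ fun t _ => hb ⟨t, rfl⟩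

/-- The modulus `|x + i y| = sup_θ (cos θ • x + sin θ • y)`. -/
def modulus [CompleteSpace X] (x y : X) : X := (exists_isLUB_modulus x y).choose

theorem isLUB_modulus [CompleteSpace X] (x y : X) :
    IsLUB (Set.range fun θ : ℝ => Real.cos θ • x + Real.sin θ • y) (modulus x y) :=
  (exists_isLUB_modulus x y).choose_spec

end Modulus

/-! ### Complex Banach lattices -/

/-- `E` is the complex Banach lattice obtained from the real Banach lattice `X`: `E` is identified
with `X × X = X + i X`, and its norm is `‖z‖ = ‖ |z| ‖`. -/
class ComplexBanachLattice (X E : Type*) [NormedAddCommGroup X] [Lattice X] [HasSolidNorm X]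
    [IsOrderedAddMonoid X] [NormedSpace ℝ X] [IsOrderedModule ℝ X] [CompleteSpace X]
    [NormedAddCommGroup E] [NormedSpace ℂ E] where
  toProd : E ≃ₗ[ℝ] X × X
  toProd_I_smul : ∀ z : E, toProd (Complex.I • z) = (-(toProd z).2, (toProd z).1)
  norm_eq : ∀ z : E, ‖z‖ = ‖modulus (toProd z).1 (toProd z).2‖

section Lattice

variable (X : Type*) {E : Type*} [NormedAddCommGroup X] [Lattice X] [HasSolidNorm X]
  [IsOrderedAddMonoid X] [NormedSpace ℝ X] [IsOrderedModule ℝ X] [CompleteSpace X]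
  [NormedAddCommGroup E] [NormedSpace ℂ E] [ComplexBanachLattice X E]

/-- The modulus `|z|` of an element of the complex Banach lattice `E = X + i X`. -/
def absVal (z : E) : X :=
  modulus (ComplexBanachLattice.toProd (X := X) z).1 (ComplexBanachLattice.toProd (X := X) z).2

variable {X} in
/-- The embedding of the real part `X = E_ℝ` into `E`. -/
def ofReal (x : X) : E := (ComplexBanachLattice.toProd (X := X) (E := E)).symm (x, 0)

/-- `f ≥ 0` in `E`. -/
def IsPos (f : E) : Prop := ∃ x : X, 0 ≤ x ∧ f = ofReal x

/-- The positive cone `E_+`. -/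
def posCone (E : Type*) [NormedAddCommGroup E] [NormedSpace ℂ E] [ComplexBanachLattice X E] :
    Set E := {f | IsPos X f}

variable {X} in
/-- The principal ideal `E_u = {f | ∃ c ≥ 0, |f| ≤ c u}` of `E`, for `u` in the real part. -/
def principalIdeal (E : Type*) [NormedAddCommGroup E] [NormedSpace ℂ E]
    [ComplexBanachLattice X E] (u : X) : Set E :=
  {f | ∃ c : ℝ, 0 ≤ c ∧ absVal X f ≤ c • u}

/-- `f` is a quasi-interior point of `E_+`, written `f ≫ 0`. -/
def IsQuasiInterior (f : E) : Prop :=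
  ∃ u : X, 0 ≤ u ∧ f = ofReal u ∧ Dense (principalIdeal E u)

/-- `T E_+ ⊆ E_+`. -/
def IsPosOp (T : E →L[ℂ] E) : Prop := ∀ f : E, IsPos X f → IsPos X (T f)

/-- `T ≫ 0`: `T f ≫ 0` whenever `f > 0`. -/
def IsStronglyPosOp (T : E →L[ℂ] E) : Prop :=
  ∀ f : E, IsPos X f → f ≠ 0 → IsQuasiInterior X (T f)

/-- A (lattice) ideal of `E`: a solid linear subspace. -/
def IsLatticeIdeal (J : Submodule ℂ E) : Prop :=
  ∀ f g : E, absVal X f ≤ absVal X g → g ∈ J → f ∈ J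

/-- `{0}` and `E` are the only closed `T`-invariant ideals. -/
def IsIrreducibleOp (T : E →L[ℂ] E) : Prop :=
  ∀ J : Submodule ℂ E, IsClosed (J : Set E) → IsLatticeIdeal X J →
    (∀ f ∈ J, T f ∈ J) → J = ⊥ ∨ J = ⊤

/-- `⟨φ, f⟩ > 0` for every `f > 0`. -/
def IsStrictlyPosFunctional (φ : StrongDual ℂ E) : Prop :=
  ∀ f : E, IsPos X f → f ≠ 0 → 0 < (φ f).re ∧ (φ f).im = 0

/-- `D(A) = D(A) ∩ E_ℝ + i (D(A) ∩ E_ℝ)` and `A (D(A) ∩ E_ℝ) ⊆ E_ℝ`. -/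
def IsRealOperator (A : E →ₗ.[ℂ] E) : Prop :=
  (A.domain : Set E) = {z | ∃ x y : X, (ofReal x : E) ∈ A.domain ∧ (ofReal y : E) ∈ A.domain ∧
    z = ofReal x + Complex.I • ofReal y} ∧
  ∀ (x : X) (hx : (ofReal x : E) ∈ A.domain), ∃ y : X, A ⟨ofReal x, hx⟩ = ofReal y

end Lattice

/-! ### Unbounded operators: kernel, range, adjoint, resolvent, spectral projection -/

section Operators

variable {Y : Type*} [NormedAddCommGroup Y] [NormedSpace ℂ Y]

/-- The operator `μ - A : D(A) → Y`. -/
def shift (A : Y →ₗ.[ℂ] Y) (μ : ℂ) : A.domain →ₗ[ℂ] Y := μ • A.domain.subtype - A.toFun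

/-- `ker (μ - A)` as a subspace of `Y`. -/
def eigenspace (A : Y →ₗ.[ℂ] Y) (μ : ℂ) : Submodule ℂ Y :=
  (LinearMap.ker (shift A μ)).map A.domain.subtype

/-- `im (μ - A)`. -/
def shiftRange (A : Y →ₗ.[ℂ] Y) (μ : ℂ) : Submodule ℂ Y := LinearMap.range (shift A μ)

/-- `ker ((μ - A) ^ n)`, with the natural domain of the power. -/
def powerKer (A : Y →ₗ.[ℂ] Y) (μ : ℂ) : ℕ → Submodule ℂ Y
  | 0 => ⊥
  | n + 1 => ((powerKer A μ n).comap (shift A μ)).map A.domain.subtype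

/-- The generalised eigenspace `⋃ n, ker ((μ - A) ^ n)`. -/
def genEigenspace (A : Y →ₗ.[ℂ] Y) (μ : ℂ) : Submodule ℂ Y := ⨆ n : ℕ, powerKer A μ n

def IsEigenvalue (A : Y →ₗ.[ℂ] Y) (μ : ℂ) : Prop := eigenspace A μ ≠ ⊥

def IsGeometricallySimple (A : Y →ₗ.[ℂ] Y) (μ : ℂ) : Prop :=
  Module.finrank ℂ (eigenspace A μ) = 1

def IsAlgebraicallySimple (A : Y →ₗ.[ℂ] Y) (μ : ℂ) : Prop :=
  IsEigenvalue A μ ∧ Module.finrank ℂ (genEigenspace A μ) = 1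

/-- The graph `{(φ, ψ) | ∀ x ∈ D(A), ⟨ψ, x⟩ = ⟨φ, A x⟩}` of the adjoint `A'`. -/
def dualGraph (A : Y →ₗ.[ℂ] Y) : Submodule ℂ (StrongDual ℂ Y × StrongDual ℂ Y) where
  carrier := {p | ∀ x : A.domain, p.2 (x : Y) = p.1 (A x)}
  add_mem' := by
    intro p q hp hq x
    simp [hp x, hq x]
  zero_mem' := by
    intro x
    simp
  smul_mem' := by
    intro c p hp x
    simp [hp x]

/-- The adjoint `A'` of a densely defined operator `A`. -/
def dualOp (A : Y →ₗ.[ℂ] Y) : StrongDual ℂ Y →ₗ.[ℂ] StrongDual ℂ Y :=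
  (dualGraph A).toLinearPMap

/-- For densely defined `A` the relation `dualGraph A` is single valued, so that it is indeed the
graph of `A'`. -/
theorem dualOp_graph (A : Y →ₗ.[ℂ] Y) (hA : Dense (A.domain : Set Y)) :
    (dualOp A).graph = dualGraph A := by
  refine Submodule.toLinearPMap_graph_eq _ ?_
  rintro ⟨φ, ψ⟩ h h0
  have h0' : φ = 0 := h0
  have hz : ∀ x ∈ (A.domain : Set Y), ψ x = 0 := by
    intro x hx
    have h1 : ψ x = φ (A ⟨x, hx⟩) := h ⟨x, hx⟩
    rw [h1, h0']
    rfl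
  change ψ = 0
  refine ContinuousLinearMap.ext fun x => ?_
  have := Continuous.ext_on hA ψ.continuous continuous_const hz
  exact congrFun this x

/-- `R` is a bounded two-sided inverse of `μ - A : D(A) → Y`. -/
def IsResolventAt (A : Y →ₗ.[ℂ] Y) (μ : ℂ) (R : Y →L[ℂ] Y) : Prop :=
  (∀ y : Y, ∃ h : R y ∈ A.domain, shift A μ ⟨R y, h⟩ = y) ∧
    ∀ x : A.domain, R (shift A μ x) = x

/-- The resolvent set `ρ(A)`. -/
def resolventSet (A : Y →ₗ.[ℂ] Y) : Set ℂ := {μ | ∃ R : Y →L[ℂ] Y, IsResolventAt A μ R}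

/-- The spectrum `σ(A)`. -/
def opSpectrum (A : Y →ₗ.[ℂ] Y) : Set ℂ := (resolventSet A)ᶜ

open Classical in
/-- The resolvent `R(μ, A) = (μ - A)⁻¹` for `μ ∈ ρ(A)` (and `0` elsewhere). -/
def opResolvent (A : Y →ₗ.[ℂ] Y) (μ : ℂ) : Y →L[ℂ] Y :=
  if h : ∃ R : Y →L[ℂ] Y, IsResolventAt A μ R then h.choose else 0

/-- `μ ∈ σ(A)` is an isolated spectral value at which `R(·, A)` has a pole. -/
def IsResolventPole (A : Y →ₗ.[ℂ] Y) (μ : ℂ) : Prop :=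
  μ ∈ opSpectrum A ∧ (∀ᶠ z in 𝓝[≠] μ, z ∈ resolventSet A) ∧
    MeromorphicAt (opResolvent A) μ ∧ meromorphicOrderAt (opResolvent A) μ < 0

/-- `μ` is a pole of order one of `R(·, A)`. -/
def IsSimpleResolventPole (A : Y →ₗ.[ℂ] Y) (μ : ℂ) : Prop :=
  IsResolventPole A μ ∧ meromorphicOrderAt (opResolvent A) μ = ((-1 : ℤ) : WithTop ℤ)

/-- The spectral projection `(2πi)⁻¹ ∮_{|z - μ| = r} R(z, A) dz` at an isolated spectral value `μ`,
for small `r > 0`; the integral is independent of `r` once `r` is small. -/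
def spectralProjection (A : Y →ₗ.[ℂ] Y) (μ : ℂ) : Y →L[ℂ] Y :=
  limUnder (𝓝[>] (0 : ℝ)) fun r : ℝ =>
    ((2 * (Real.pi : ℂ) * Complex.I)⁻¹ • ∮ z in C(μ, r), opResolvent A z : Y →L[ℂ] Y)

end Operators

end StrongProjections

end

/-! Near the pole $\mu=\lambda_0$ write $R(z,A) = (z-\mu)^{-M} g(z)$ with $g$ analytic, and let
$c_k$ be the Taylor coefficients of $g$ at $\mu$. Multiplying by $\mu - A$ on either side and
comparing coefficients gives $(\mu-A)c_k = \delta_{kM} - c_{k-1}$ and, on $D(A)$, $c_k(\mu-A) =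
\delta_{kM} - c_{k-1}$. Since $P = c_{M-1}$, all the spectral theory needed follows from these two
recurrences: $P$ maps into the generalised eigenspace and fixes it, $1-P$ maps into
$\operatorname{im}(\mu-A)$, and if $P$ maps into $\ker(\mu-A)$ the pole is simple
(`exists_isLaurent_one`).

The order theory concerns a single positive projection. If it is nonzero and irreducible, its null
ideal is trivial and the principal ideal of each nonzero positive image is dense, so it is strongly
positive (`IsIrreducibleOp.isStronglyPosOp`); the converse holds for any strongly positive operator.
If it is strongly positive, its real fixed space is totally ordered, hence one-dimensional
(`IsStronglyPosOp.exists_range_eq_span`), so $P = \varphi\otimes u$ with $u$ quasi-interior and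
$\varphi$ strictly positive.

This form of $P$ gives (iii). From (iii), $\varphi$ annihilates the range of $\lambda_0-A$, which
excludes both Jordan chains and positive elements of the range, giving (iv). From (iv), $Pf = cu$
with $f - cu$ in the range; realness of $A$ and the condition on the range force $c>0$ when $f>0$
(`isStronglyPosOp_of_algebraicallySimple`). The simple pole passes to $A'$ by taking adjoints of the
Laurent form, and pairing with $\varphi$ excludes positive eigenvectors for other eigenvalues. -/

noncomputable section

namespace StrongProjections

/-! ### Iterated difference quotients and their circle integrals -/

section Quotients

variable {F : Type*} [NormedAddCommGroup F] [NormedSpace ℂ F]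

/-- The `k`-fold difference quotient of `g` at `c`; its value at `c` is the `k`-th Taylor
coefficient. -/
def iterDslope (g : ℂ → F) (c : ℂ) : ℕ → ℂ → F
  | 0 => g
  | k + 1 => dslope (iterDslope g c k) c

theorem analyticAt_iterDslope {g : ℂ → F} {c : ℂ} (hg : AnalyticAt ℂ g c) (k : ℕ) :
    AnalyticAt ℂ (iterDslope g c k) c := by
  induction k with
  | zero => exact hg
  | succ k ih =>
    obtain ⟨p, hp⟩ := ih
    exact ⟨_, hp.has_fpower_series_dslope_fslope⟩

theorem sub_smul_iterDslope_succ (g : ℂ → F) (c : ℂ) (k : ℕ) (z : ℂ) :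
    (z - c) • iterDslope g c (k + 1) z = iterDslope g c k z - iterDslope g c k c :=
  sub_smul_dslope _ _ _

theorem eventually_continuousOn_sphere [CompleteSpace F] {g : ℂ → F} {c : ℂ} (hg : AnalyticAt ℂ g c) :
    ∀ᶠ r in 𝓝[>] (0 : ℝ), ContinuousOn g (Metric.sphere c r) ∧
      DiffContOnCl ℂ g (Metric.ball c r) := by
  obtain ⟨ε, hε, hball⟩ := Metric.eventually_nhds_iff_ball.1 hg.eventually_analyticAt
  filter_upwards [Ioo_mem_nhdsGT hε] with r hr
  have hd : DifferentiableOn ℂ g (Metric.ball c ε) := fun z hz =>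
    (hball z hz).differentiableAt.differentiableWithinAt
  have hsub : Metric.closedBall c r ⊆ Metric.ball c ε := Metric.closedBall_subset_ball hr.2
  exact ⟨hd.continuousOn.mono (Metric.sphere_subset_closedBall.trans hsub),
    hd.diffContOnCl_ball hsub⟩

/-- Each step splits off the value of the quotient at $c$, whose term is a power of exponent at most
$-2$ and integrates to zero, and lowers the pole order by one; Cauchy's formula handles order one.
Only finitely many quotients occur, so one small radius serves for all of them. -/
theorem eventually_circleIntegral_eq_iterDslope [CompleteSpace F] {c : ℂ} (n : ℕ) {g : ℂ → F}
    (hg : AnalyticAt ℂ g c) :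
    ∀ᶠ r in 𝓝[>] (0 : ℝ), ∀ k m : ℕ, k + m = n →
      (∮ z in C(c, r), ((z - c) ^ (m + 1))⁻¹ • iterDslope g c k z) =
        (2 * (Real.pi : ℂ) * Complex.I) • iterDslope g c n c := by
  have hev : ∀ᶠ r in 𝓝[>] (0 : ℝ), ∀ k ∈ Finset.range (n + 1),
      ContinuousOn (iterDslope g c k) (Metric.sphere c r) ∧
        DiffContOnCl ℂ (iterDslope g c k) (Metric.ball c r) :=
    (Filter.eventually_all_finset _).2 fun k _ =>
      eventually_continuousOn_sphere (analyticAt_iterDslope hg k)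
  filter_upwards [hev, self_mem_nhdsWithin] with r hr hr0
  replace hr0 : 0 < r := hr0
  intro k m
  induction m generalizing k with
  | zero =>
    rintro rfl
    have := (hr k (by simp)).2.circleIntegral_sub_inv_smul (Metric.mem_ball_self hr0)
    simpa using this
  | succ m ih =>
    intro hkm
    have hne : ∀ z ∈ Metric.sphere c r, z - c ≠ 0 := fun z hz =>
      sub_ne_zero.2 (Metric.ne_of_mem_sphere hz hr0.ne')
    have hpow : ∀ j : ℕ, ContinuousOn (fun z : ℂ => ((z - c) ^ j)⁻¹) (Metric.sphere c r) :=
      fun j => ContinuousOn.inv₀ (by fun_prop) fun z hz => pow_ne_zero _ (hne z hz)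
    have e : Set.EqOn (fun z => ((z - c) ^ (m + 1 + 1))⁻¹ • iterDslope g c k z)
        (fun z => ((z - c) ^ (m + 1 + 1))⁻¹ • iterDslope g c k c +
          ((z - c) ^ (m + 1))⁻¹ • iterDslope g c (k + 1) z) (Metric.sphere c r) := by
      intro z hz
      have h1 : iterDslope g c k z =
          iterDslope g c k c + (z - c) • iterDslope g c (k + 1) z := by
        rw [sub_smul_iterDslope_succ]; abel
      have h2 := hne z hz
      simp only
      rw [h1, smul_add, smul_smul]
      congr 2
      rw [pow_succ' (z - c) (m + 1), mul_inv, mul_comm, ← mul_assoc, mul_inv_cancel₀ h2, one_mul]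
    have h0 : (∮ z in C(c, r), ((z - c) ^ (m + 1 + 1))⁻¹) = 0 := by
      have := circleIntegral.integral_sub_zpow_of_ne (n := -((m + 1 + 1 : ℕ) : ℤ))
        (by push_cast; omega) c c r
      simpa only [zpow_neg, zpow_natCast] using this
    rw [circleIntegral.integral_congr hr0.le e, circleIntegral.integral_add,
      circleIntegral.integral_smul_const, h0, zero_smul, zero_add, ih (k + 1) (by omega)]
    · exact ((hpow _).smul continuousOn_const).circleIntegrable hr0.le
    · exact ((hpow _).smul (hr (k + 1) (by simp; omega)).1).circleIntegrable hr0.le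

end Quotients

/-! ### The graph of `μ - A` and the resolvent -/

section Resolvent

variable {Y : Type*} [NormedAddCommGroup Y] [NormedSpace ℂ Y] {A : Y →ₗ.[ℂ] Y} {μ : ℂ}

/-- The graph of `μ - A`. -/
def shiftGraph (A : Y →ₗ.[ℂ] Y) (μ : ℂ) : Submodule ℂ (Y × Y) :=
  A.graph.comap ((LinearMap.fst ℂ Y Y).prod (μ • LinearMap.fst ℂ Y Y - LinearMap.snd ℂ Y Y))

theorem mem_shiftGraph {x y : Y} :
    (x, y) ∈ shiftGraph A μ ↔ (x, μ • x - y) ∈ A.graph := Iff.rfl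

theorem mem_shiftGraph_iff {x y : Y} :
    (x, y) ∈ shiftGraph A μ ↔ ∃ h : x ∈ A.domain, shift A μ ⟨x, h⟩ = y := by
  rw [mem_shiftGraph, LinearPMap.mem_graph_iff]
  constructor
  · rintro ⟨z, rfl, h⟩
    refine ⟨z.2, ?_⟩
    change μ • (z : Y) - A z = y
    rw [h]; simp
  · rintro ⟨h, rfl⟩
    refine ⟨⟨x, h⟩, rfl, ?_⟩
    change A ⟨x, h⟩ = μ • x - (μ • x - A ⟨x, h⟩)
    simp

theorem isClosed_shiftGraph (hA : A.IsClosed) (μ : ℂ) :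
    IsClosed (shiftGraph A μ : Set (Y × Y)) := by
  have hc : Continuous fun p : Y × Y => (p.1, μ • p.1 - p.2) := by fun_prop
  exact IsClosed.preimage hc hA

theorem mem_eigenspace_iff {x : Y} : x ∈ eigenspace A μ ↔ (x, 0) ∈ shiftGraph A μ := by
  rw [mem_shiftGraph_iff, eigenspace, Submodule.mem_map]
  constructor
  · rintro ⟨z, hz, rfl⟩
    exact ⟨z.2, hz⟩
  · rintro ⟨h, hx⟩
    exact ⟨⟨x, h⟩, hx, rfl⟩

theorem mem_shiftRange_iff {y : Y} : y ∈ shiftRange A μ ↔ ∃ x, (x, y) ∈ shiftGraph A μ := by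
  simp only [mem_shiftGraph_iff, shiftRange, LinearMap.mem_range, Subtype.exists]

theorem mem_powerKer_succ_iff {n : ℕ} {x : Y} :
    x ∈ powerKer A μ (n + 1) ↔ ∃ y ∈ powerKer A μ n, (x, y) ∈ shiftGraph A μ := by
  simp only [mem_shiftGraph_iff, powerKer, Submodule.mem_map, Submodule.mem_comap]
  constructor
  · rintro ⟨z, hz, rfl⟩
    exact ⟨_, hz, z.2, rfl⟩
  · rintro ⟨y, hy, h, rfl⟩
    exact ⟨⟨x, h⟩, hy, rfl⟩

theorem mem_powerKer_one_iff {x : Y} : x ∈ powerKer A μ 1 ↔ x ∈ eigenspace A μ := by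
  rw [mem_powerKer_succ_iff, mem_eigenspace_iff]
  simp [powerKer]

theorem powerKer_le_genEigenspace (A : Y →ₗ.[ℂ] Y) (μ : ℂ) (n : ℕ) :
    powerKer A μ n ≤ genEigenspace A μ := le_iSup (powerKer A μ) n

theorem eigenspace_le_genEigenspace (A : Y →ₗ.[ℂ] Y) (μ : ℂ) :
    eigenspace A μ ≤ genEigenspace A μ := fun _ hx =>
  powerKer_le_genEigenspace A μ 1 (mem_powerKer_one_iff.2 hx)

theorem IsResolventAt.mem_shiftGraph {R : Y →L[ℂ] Y} (h : IsResolventAt A μ R) (y : Y) :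
    (R y, y) ∈ shiftGraph A μ := mem_shiftGraph_iff.2 (h.1 y)

theorem IsResolventAt.apply_of_mem_shiftGraph {R : Y →L[ℂ] Y} (h : IsResolventAt A μ R) {x y : Y}
    (hxy : (x, y) ∈ shiftGraph A μ) : R y = x := by
  obtain ⟨hx, rfl⟩ := mem_shiftGraph_iff.1 hxy
  exact h.2 ⟨x, hx⟩

theorem isResolventAt_iff {R : Y →L[ℂ] Y} : IsResolventAt A μ R ↔
    (∀ y, (R y, y) ∈ shiftGraph A μ) ∧ ∀ x y, (x, y) ∈ shiftGraph A μ → R y = x := by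
  refine ⟨fun h => ⟨h.mem_shiftGraph, fun x y => h.apply_of_mem_shiftGraph⟩, fun h => ⟨?_, ?_⟩⟩
  · exact fun y => mem_shiftGraph_iff.1 (h.1 y)
  · exact fun x => h.2 _ _ (mem_shiftGraph_iff.2 ⟨x.2, rfl⟩)

theorem isResolventAt_opResolvent {z : ℂ} (hz : z ∈ resolventSet A) :
    IsResolventAt A z (opResolvent A z) := by
  have h : ∃ R : Y →L[ℂ] Y, IsResolventAt A z R := hz
  rw [opResolvent, dif_pos h]
  exact h.choose_spec

theorem IsResolventAt.opResolvent_eq {z : ℂ} {R : Y →L[ℂ] Y} (h : IsResolventAt A z R) :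
    opResolvent A z = R := by
  ext y
  exact (isResolventAt_opResolvent ⟨R, h⟩).apply_of_mem_shiftGraph (h.mem_shiftGraph y)

theorem mem_opSpectrum_of_mem_eigenspace {x : Y} (hx : x ∈ eigenspace A μ) (hx0 : x ≠ 0) :
    μ ∈ opSpectrum A := by
  rintro ⟨R, hR⟩
  apply hx0
  rw [← hR.apply_of_mem_shiftGraph (mem_eigenspace_iff.1 hx), map_zero]

theorem shiftGraph_change {z : ℂ} {x y : Y} (h : (x, y) ∈ shiftGraph A z) :
    (x, y - (z - μ) • x) ∈ shiftGraph A μ := by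
  rw [StrongProjections.mem_shiftGraph] at h ⊢
  convert h using 2
  rw [sub_smul]; abel

end Resolvent

/-! ### Laurent expansion of the resolvent -/

section Laurent

variable {Y : Type*} [NormedAddCommGroup Y] [NormedSpace ℂ Y] {A : Y →ₗ.[ℂ] Y} {μ : ℂ}

/-- Near `μ` the resolvent of `A` is `(z - μ) ^ (-M) • g z`, with `g` analytic at `μ`. -/
structure IsLaurent (A : Y →ₗ.[ℂ] Y) (μ : ℂ) (M : ℕ) (g : ℂ → Y →L[ℂ] Y) : Prop where
  analyticAt : AnalyticAt ℂ g μ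
  eventually_mem : ∀ᶠ z in 𝓝[≠] μ, z ∈ resolventSet A
  eventually_eq : ∀ᶠ z in 𝓝[≠] μ, opResolvent A z = ((z - μ) ^ M)⁻¹ • g z

theorem IsResolventPole.exists_isLaurent (h : IsResolventPole A μ) :
    ∃ (m : ℕ) (g : ℂ → Y →L[ℂ] Y), g μ ≠ 0 ∧ IsLaurent A μ (m + 1) g := by
  obtain ⟨-, hev, hmer, hord⟩ := h
  obtain ⟨n, hn⟩ := WithTop.ne_top_iff_exists.1 hord.ne_top
  obtain ⟨g, hg, hg0, heq⟩ := (meromorphicOrderAt_eq_int_iff hmer).1 hn.symm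
  have hn0 : n < 0 := by rw [← hn] at hord; exact_mod_cast hord
  obtain ⟨m, hm⟩ := Int.eq_negSucc_of_lt_zero hn0
  refine ⟨m, g, hg0, hg, hev, ?_⟩
  filter_upwards [heq] with z hz
  rw [hz, hm, zpow_negSucc]

/-- The coefficient preceding `iterDslope g μ k μ`. -/
def prevCoeff (g : ℂ → Y →L[ℂ] Y) (μ : ℂ) : ℕ → Y →L[ℂ] Y
  | 0 => 0
  | k + 1 => iterDslope g μ k μ

namespace IsLaurent

variable {M : ℕ} {g : ℂ → Y →L[ℂ] Y}

theorem tendsto_iterDslope (h : IsLaurent A μ M g) (k : ℕ) (y : Y) :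
    Tendsto (fun z => iterDslope g μ k z y) (𝓝[≠] μ) (𝓝 (iterDslope g μ k μ y)) := by
  have h1 : Tendsto (iterDslope g μ k) (𝓝[≠] μ) (𝓝 (iterDslope g μ k μ)) :=
    (analyticAt_iterDslope h.analyticAt k).continuousAt.tendsto.mono_left nhdsWithin_le_nhds
  exact ((ContinuousLinearMap.apply ℂ Y y).continuous.tendsto _).comp h1

theorem tendsto_sub_pow (n : ℕ) :
    Tendsto (fun z : ℂ => (z - μ) ^ n) (𝓝[≠] μ) (𝓝 (0 ^ n)) := by
  have : Continuous fun z : ℂ => (z - μ) ^ n := by fun_prop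
  have h := this.tendsto μ
  rw [sub_self] at h
  exact h.mono_left nhdsWithin_le_nhds

theorem tendsto_remainder (h : IsLaurent A μ M g) (k n : ℕ) (x : Y) :
    Tendsto (fun z => (z - μ) ^ n • x - (z - μ) • iterDslope g μ k z x - prevCoeff g μ k x)
      (𝓝[≠] μ) (𝓝 ((0 : ℂ) ^ n • x - prevCoeff g μ k x)) := by
  have h1 := ((tendsto_sub_pow (μ := μ) 1).smul (h.tendsto_iterDslope k x))
  simp only [pow_one, zero_smul] at h1
  simpa using (((tendsto_sub_pow (μ := μ) n).smul_const x).sub h1).sub_const (prevCoeff g μ k x)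

/-- The inductive step on the Laurent side: subtracting the limit at $\mu$ and dividing by $z-\mu$
turns the identity of index $k$ into that of index $k+1$. -/
theorem remainder_succ {z : ℂ} (hz : z - μ ≠ 0) (k n : ℕ) (x : Y) :
    (z - μ)⁻¹ • (((z - μ) ^ (n + 1) • x - (z - μ) • iterDslope g μ k z x - prevCoeff g μ k x) -
        ((0 : ℂ) ^ (n + 1) • x - prevCoeff g μ k x)) =
      (z - μ) ^ n • x - (z - μ) • iterDslope g μ (k + 1) z x - prevCoeff g μ (k + 1) x := by
  have e : (z - μ) • iterDslope g μ (k + 1) z x = iterDslope g μ k z x - iterDslope g μ k μ x := by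
    have := congrArg (fun T : Y →L[ℂ] Y => T x) (sub_smul_iterDslope_succ g μ k z)
    simpa using this
  have e2 : ((z - μ) ^ (n + 1) • x - (z - μ) • iterDslope g μ k z x - prevCoeff g μ k x) -
        ((0 : ℂ) ^ (n + 1) • x - prevCoeff g μ k x) =
      (z - μ) • ((z - μ) ^ n • x - iterDslope g μ k z x) := by
    rw [smul_sub, smul_smul, ← pow_succ']
    simp
  rw [e2, smul_smul, inv_mul_cancel₀ hz, one_smul, e, prevCoeff]
  abel

theorem iterDslope_succ_apply {z : ℂ} (hz : z - μ ≠ 0) (k : ℕ) (x : Y) :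
    iterDslope g μ (k + 1) z x =
      (z - μ)⁻¹ • (iterDslope g μ k z x - iterDslope g μ k μ x) := by
  have := congrArg (fun T : Y →L[ℂ] Y => (z - μ)⁻¹ • T x) (sub_smul_iterDslope_succ g μ k z)
  simpa [smul_smul, inv_mul_cancel₀ hz] using this

theorem eventually_sub_ne_zero : ∀ᶠ z in 𝓝[≠] μ, z - μ ≠ 0 := by
  filter_upwards [self_mem_nhdsWithin] with z hz using sub_ne_zero.2 hz

theorem eventually_isResolventAt (h : IsLaurent A μ M g) :
    ∀ᶠ z in 𝓝[≠] μ, IsResolventAt A z (((z - μ) ^ M)⁻¹ • g z) := by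
  filter_upwards [h.eventually_mem, h.eventually_eq] with z h1 h2
  rw [← h2]
  exact isResolventAt_opResolvent h1

theorem coeff_mem_aux (hA : A.IsClosed) (k n : ℕ) (h : IsLaurent A μ M g)
    (H : ∀ᶠ z in 𝓝[≠] μ, ∀ y, (iterDslope g μ k z y,
      (z - μ) ^ n • y - (z - μ) • iterDslope g μ k z y - prevCoeff g μ k y) ∈ shiftGraph A μ)
    (y : Y) :
    (iterDslope g μ k μ y, (0 : ℂ) ^ n • y - prevCoeff g μ k y) ∈ shiftGraph A μ :=
  (isClosed_shiftGraph hA μ).mem_of_tendsto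
    ((h.tendsto_iterDslope k y).prodMk_nhds (h.tendsto_remainder k n y)) (H.mono fun _ hz => hz y)

/-- For $k=0$ this is $(\mu-A)R(z,A) = 1-(z-\mu)R(z,A)$ multiplied by $(z-\mu)^M$. Closedness of $A$
puts the limit $z\to\mu$ in the graph; the graph being linear, the limit can be subtracted and the
difference divided by $z-\mu$. -/
theorem eventually_mem_shiftGraph (hA : A.IsClosed) (h : IsLaurent A μ M g) (k : ℕ) :
    ∀ n, k + n = M → ∀ᶠ z in 𝓝[≠] μ, ∀ y, (iterDslope g μ k z y,
      (z - μ) ^ n • y - (z - μ) • iterDslope g μ k z y - prevCoeff g μ k y) ∈ shiftGraph A μ := by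
  induction k with
  | zero =>
    intro n hn
    obtain rfl : n = M := by omega
    filter_upwards [h.eventually_isResolventAt, eventually_sub_ne_zero] with z hz hz0 y
    have h1 := shiftGraph_change (μ := μ) (hz.mem_shiftGraph ((z - μ) ^ n • y))
    simpa [smul_smul, mul_inv_cancel₀ (pow_ne_zero n hz0), iterDslope, prevCoeff] using h1
  | succ k ih =>
    intro n hn
    have H := ih (n + 1) (by omega)
    have H0 := h.coeff_mem_aux hA k (n + 1) H
    filter_upwards [H, eventually_sub_ne_zero] with z hz hz0 y
    have h1 := (shiftGraph A μ).smul_mem (z - μ)⁻¹ ((shiftGraph A μ).sub_mem (hz y) (H0 y))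
    rwa [Prod.mk_sub_mk, Prod.smul_mk, remainder_succ hz0, ← iterDslope_succ_apply hz0] at h1

/-- The left recurrence $(\mu-A)c_k = \delta_{kM} - c_{k-1}$. The factor $0^n$ with $n = M-k$ plays
the role of the Kronecker delta, since $0^0 = 1$. -/
theorem coeff_mem_shiftGraph (hA : A.IsClosed) (h : IsLaurent A μ M g) {k n : ℕ} (hkn : k + n = M)
    (y : Y) : (iterDslope g μ k μ y, (0 : ℂ) ^ n • y - prevCoeff g μ k y) ∈ shiftGraph A μ :=
  h.coeff_mem_aux hA k n (h.eventually_mem_shiftGraph hA k n hkn) y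

theorem coeff_apply_aux (k n : ℕ) (h : IsLaurent A μ M g)
    (H : ∀ᶠ z in 𝓝[≠] μ, ∀ x v, (x, v) ∈ shiftGraph A μ → iterDslope g μ k z v =
      (z - μ) ^ n • x - (z - μ) • iterDslope g μ k z x - prevCoeff g μ k x)
    {x v : Y} (hxv : (x, v) ∈ shiftGraph A μ) :
    iterDslope g μ k μ v = (0 : ℂ) ^ n • x - prevCoeff g μ k x :=
  tendsto_nhds_unique (h.tendsto_iterDslope k v)
    ((h.tendsto_remainder k n x).congr' (H.mono fun _ hz => (hz x v hxv).symm))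

/-- The same division process for $R(z,A)(\mu-A)$. Only bounded operators are evaluated here, so the
limit needs no closedness of $A$. -/
theorem eventually_apply (h : IsLaurent A μ M g) (k : ℕ) :
    ∀ n, k + n = M → ∀ᶠ z in 𝓝[≠] μ, ∀ x v, (x, v) ∈ shiftGraph A μ → iterDslope g μ k z v =
      (z - μ) ^ n • x - (z - μ) • iterDslope g μ k z x - prevCoeff g μ k x := by
  induction k with
  | zero =>
    intro n hn
    obtain rfl : n = M := by omega
    filter_upwards [h.eventually_isResolventAt, eventually_sub_ne_zero] with z hz hz0 x v hxv
    have h1 := hz.apply_of_mem_shiftGraph (shiftGraph_change (μ := z) hxv)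
    have h2 : g z (v - (μ - z) • x) = (z - μ) ^ n • x := by
      have := congrArg (fun w => (z - μ) ^ n • w) h1
      simpa only [FunLike.coe_smul, Pi.smul_apply, smul_smul,
        mul_inv_cancel₀ (pow_ne_zero n hz0), one_smul] using this
    rw [map_sub, map_smul] at h2
    simp only [iterDslope, prevCoeff, zero_apply, sub_zero]
    rw [← h2, ← neg_sub z μ, neg_smul]
    abel
  | succ k ih =>
    intro n hn
    have H := ih (n + 1) (by omega)
    filter_upwards [H, eventually_sub_ne_zero] with z hz hz0 x v hxv
    rw [← remainder_succ hz0, iterDslope_succ_apply hz0, ← hz x v hxv,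
      ← h.coeff_apply_aux k (n + 1) H hxv]

theorem coeff_apply (h : IsLaurent A μ M g) {k n : ℕ} (hkn : k + n = M) {x v : Y}
    (hxv : (x, v) ∈ shiftGraph A μ) :
    iterDslope g μ k μ v = (0 : ℂ) ^ n • x - prevCoeff g μ k x :=
  h.coeff_apply_aux k n (h.eventually_apply k n hkn) hxv

variable {m : ℕ}

theorem spectralProjection_eq [CompleteSpace Y] (h : IsLaurent A μ (m + 1) g) :
    spectralProjection A μ = iterDslope g μ m μ := by
  have h1 := eventually_circleIntegral_eq_iterDslope m h.analyticAt
  obtain ⟨ε, hε, hball⟩ := Metric.eventually_nhds_iff_ball.1 (eventually_nhdsWithin_iff.1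
    h.eventually_eq)
  refine Tendsto.limUnder_eq (tendsto_const_nhds.congr' ?_)
  filter_upwards [h1, Ioo_mem_nhdsGT hε] with r hr hrε
  have e : Set.EqOn (opResolvent A) (fun z => ((z - μ) ^ (m + 1))⁻¹ • iterDslope g μ 0 z)
      (Metric.sphere μ r) := by
    intro z hz
    refine hball z ?_ (Metric.ne_of_mem_sphere hz hrε.1.ne')
    rw [Metric.mem_ball, Metric.mem_sphere.1 hz]
    exact hrε.2
  rw [circleIntegral.integral_congr hrε.1.le e, hr 0 m (by simp), smul_smul, inv_mul_cancel₀,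
    one_smul]
  simp [Real.pi_ne_zero]

/-- Below the top index the recurrence reads $(\mu-A)c_k = -c_{k-1}$, with $c_{-1}=0$, so the
coefficients of the principal part form Jordan chains. -/
theorem coeff_apply_mem_powerKer (hA : A.IsClosed) (h : IsLaurent A μ (m + 1) g) (k : ℕ)
    (hk : k ≤ m) (y : Y) : iterDslope g μ k μ y ∈ powerKer A μ (k + 1) := by
  induction k with
  | zero =>
    have := h.coeff_mem_shiftGraph hA (k := 0) (n := m + 1) (by simp) y
    rw [mem_powerKer_one_iff, mem_eigenspace_iff]
    simpa [prevCoeff] using this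
  | succ k ih =>
    have := h.coeff_mem_shiftGraph hA (k := k + 1) (n := m - k) (by omega) y
    rw [zero_pow (by omega), zero_smul, zero_sub] at this
    exact mem_powerKer_succ_iff.2 ⟨_, neg_mem (ih (by omega)), this⟩

end IsLaurent

end Laurent

/-! ### Spectral projection at a pole: range, kernel and order of the pole -/

section SpectralProjection

variable {Y : Type*} [NormedAddCommGroup Y] [NormedSpace ℂ Y] [CompleteSpace Y]
  {A : Y →ₗ.[ℂ] Y} {μ : ℂ}

theorem spectralProjection_mem_genEigenspace (hA : A.IsClosed) (h : IsResolventPole A μ) (y : Y) :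
    spectralProjection A μ y ∈ genEigenspace A μ := by
  obtain ⟨m, g, -, hg⟩ := h.exists_isLaurent
  rw [hg.spectralProjection_eq]
  exact powerKer_le_genEigenspace A μ _ (hg.coeff_apply_mem_powerKer hA m le_rfl y)

theorem sub_spectralProjection_mem_shiftRange (hA : A.IsClosed) (h : IsResolventPole A μ) (y : Y) :
    y - spectralProjection A μ y ∈ shiftRange A μ := by
  obtain ⟨m, g, -, hg⟩ := h.exists_isLaurent
  rw [hg.spectralProjection_eq, mem_shiftRange_iff]
  -- The preimage is $c_{m+1}y$, the constant term of the Laurent series; at this index the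
  -- recurrence is $(\mu-A)c_{m+1} = 1-P$.
  exact ⟨_, by simpa [prevCoeff] using hg.coeff_mem_shiftGraph hA (k := m + 1) (n := 0) rfl y⟩

theorem spectralProjection_apply_of_mem_genEigenspace (h : IsResolventPole A μ) {y : Y}
    (hy : y ∈ genEigenspace A μ) : spectralProjection A μ y = y := by
  obtain ⟨m, g, -, hg⟩ := h.exists_isLaurent
  -- The induction also carries the vanishing of the regular part of the resolvent on the
  -- generalised eigenspace: if it vanishes at $v = (\mu-A)y$, then $y - Py = c_{m+1}v = 0$, and the
  -- identity at nearby $z$ gives the vanishing at $y$.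
  have key : ∀ n, ∀ y ∈ powerKer A μ n, spectralProjection A μ y = y ∧
      ∀ᶠ z in 𝓝[≠] μ, iterDslope g μ (m + 1) z y = 0 := by
    intro n
    induction n with
    | zero =>
      intro y hy
      obtain rfl : y = 0 := hy
      simp
    | succ n ih =>
      intro y hy
      obtain ⟨v, hv, hyv⟩ := mem_powerKer_succ_iff.1 hy
      obtain ⟨-, hv0⟩ := ih v hv
      have hP : y - spectralProjection A μ y = 0 := by
        have h1 := hg.coeff_apply (k := m + 1) (n := 0) rfl hyv
        have h2 : iterDslope g μ (m + 1) μ v = 0 :=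
          tendsto_nhds_unique (hg.tendsto_iterDslope (m + 1) v)
            (tendsto_const_nhds.congr' (hv0.mono fun _ hz => hz.symm))
        rw [h2] at h1
        rw [hg.spectralProjection_eq]
        simpa [prevCoeff] using h1.symm
      refine ⟨(sub_eq_zero.1 hP).symm, ?_⟩
      filter_upwards [hv0, hg.eventually_apply (m + 1) 0 rfl, IsLaurent.eventually_sub_ne_zero]
        with z hz1 hz2 hz0
      have h3 := hz2 y v hyv
      rw [hg.spectralProjection_eq] at hP
      rw [hz1, pow_zero, one_smul, sub_right_comm, prevCoeff, hP, zero_sub, eq_comm,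
        neg_eq_zero] at h3
      exact (smul_eq_zero.1 h3).resolve_left hz0
  have hle : genEigenspace A μ ≤ LinearMap.eqLocus (spectralProjection A μ).toLinearMap
      LinearMap.id := iSup_le fun n y hy => (key n y hy).1
  exact hle hy

theorem spectralProjection_apply_of_mem_eigenspace (h : IsResolventPole A μ) {y : Y}
    (hy : y ∈ eigenspace A μ) : spectralProjection A μ y = y :=
  spectralProjection_apply_of_mem_genEigenspace h (eigenspace_le_genEigenspace A μ hy)

theorem spectralProjection_idem (hA : A.IsClosed) (h : IsResolventPole A μ) (y : Y) :
    spectralProjection A μ (spectralProjection A μ y) = spectralProjection A μ y :=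
  spectralProjection_apply_of_mem_genEigenspace h (spectralProjection_mem_genEigenspace hA h y)

/-- At index $m$ both recurrences have the same right-hand side $-c_{m-1}$, so $(\mu-A)P$ extends
$P(\mu-A)$. -/
theorem spectralProjection_commute (hA : A.IsClosed) (h : IsResolventPole A μ) {x v : Y}
    (hxv : (x, v) ∈ shiftGraph A μ) :
    (spectralProjection A μ x, spectralProjection A μ v) ∈ shiftGraph A μ := by
  obtain ⟨m, g, -, hg⟩ := h.exists_isLaurent
  have h1 := hg.coeff_mem_shiftGraph hA (k := m) (n := 1) rfl x
  rwa [← hg.coeff_apply (k := m) (n := 1) rfl hxv, ← hg.spectralProjection_eq] at h1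

theorem spectralProjection_eq_zero_of_mem_shiftRange (hA : A.IsClosed) (h : IsResolventPole A μ)
    (hP : ∀ y, spectralProjection A μ y ∈ eigenspace A μ) {v : Y} (hv : v ∈ shiftRange A μ) :
    spectralProjection A μ v = 0 := by
  obtain ⟨x, hx⟩ := mem_shiftRange_iff.1 hv
  have h1 := spectralProjection_commute hA h hx
  have h2 := mem_eigenspace_iff.1 (hP x)
  exact LinearPMap.mem_graph_snd_inj A h1 h2 rfl |> fun e => by simpa using e

/-- If the range of the spectral projection consists of eigenvectors, the resolvent has the form
`(z - μ)⁻¹ • g z` with `g` analytic and `g μ` the spectral projection. -/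
theorem exists_isLaurent_one (hA : A.IsClosed) (h : IsResolventPole A μ)
    (hP : ∀ y, spectralProjection A μ y ∈ eigenspace A μ) :
    ∃ g : ℂ → Y →L[ℂ] Y, IsLaurent A μ 1 g ∧ g μ = spectralProjection A μ := by
  obtain ⟨m, g, hg0, hg⟩ := h.exists_isLaurent
  obtain rfl | ⟨m, rfl⟩ : m = 0 ∨ ∃ j, m = j + 1 := by cases m <;> simp
  · exact ⟨g, hg, hg.spectralProjection_eq.symm⟩
  · exfalso
    -- Here the pole has order $m+2$ and $P = c_{m+1}$. From $(\mu-A)P = 0$ follows $c_m = 0$, and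
    -- descending along $(\mu-A)c_{k+1} = -c_k$ all lower coefficients vanish, including $c_0 =
    -- g(\mu) \ne 0$.
    have key : ∀ k j, k + j = m → iterDslope g μ k μ = 0 := by
      intro k j
      induction j generalizing k with
      | zero =>
        rintro rfl
        ext y
        have h1 := hg.coeff_mem_shiftGraph hA (k := k + 1) (n := 1) rfl y
        have h2 := mem_eigenspace_iff.1 (hP y)
        rw [hg.spectralProjection_eq] at h2
        have h3 := LinearPMap.mem_graph_snd_inj A h1 h2 rfl
        simpa [prevCoeff] using h3
      | succ j ih =>
        intro hk
        ext y
        have h1 := hg.coeff_mem_shiftGraph hA (k := k + 1) (n := j + 2) (by omega) y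
        rw [ih (k + 1) (by omega), zero_apply] at h1
        have h3 := LinearPMap.mem_graph_snd_inj A h1 (shiftGraph A μ).zero_mem rfl
        simpa [prevCoeff] using h3
    exact hg0 (key 0 m (by simp))

theorem isSimpleResolventPole_of_isLaurent {M : Type*} [NormedAddCommGroup M] [NormedSpace ℂ M]
    {B : M →ₗ.[ℂ] M} {g : ℂ → M →L[ℂ] M} (h : IsLaurent B μ 1 g) (hg0 : g μ ≠ 0)
    (hμ : μ ∈ opSpectrum B) : IsSimpleResolventPole B μ := by
  have heq : ∀ᶠ z in 𝓝[≠] μ, opResolvent B z = (z - μ) ^ (-1 : ℤ) • g z := by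
    filter_upwards [h.eventually_eq] with z hz
    rw [hz, zpow_neg_one, pow_one]
  have hmer : MeromorphicAt (opResolvent B) μ := by
    have h1 : MeromorphicAt (fun z => (z - μ) ^ (-1 : ℤ) • g z) μ := by
      have := h.analyticAt.meromorphicAt
      fun_prop
    exact h1.congr (heq.mono fun z hz => hz.symm)
  have hord := (meromorphicOrderAt_eq_int_iff hmer).2 ⟨g, h.analyticAt, hg0, heq⟩
  refine ⟨⟨hμ, h.eventually_mem, hmer, ?_⟩, hord⟩
  rw [hord]
  exact_mod_cast (by norm_num : (-1 : ℤ) < 0)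

end SpectralProjection

/-! ### The adjoint -/

section Dual

variable {Y : Type*} [NormedAddCommGroup Y] [NormedSpace ℂ Y] {A : Y →ₗ.[ℂ] Y} {μ : ℂ}

theorem mem_shiftGraph_dualOp_iff (hA : Dense (A.domain : Set Y)) {φ ψ : StrongDual ℂ Y} :
    (φ, ψ) ∈ shiftGraph (dualOp A) μ ↔ ∀ x y, (x, y) ∈ shiftGraph A μ → ψ x = φ y := by
  rw [mem_shiftGraph, dualOp_graph A hA]
  change (∀ x : A.domain, (μ • φ - ψ) (x : Y) = φ (A x)) ↔ _
  constructor
  · intro h x y hxy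
    obtain ⟨hx, rfl⟩ := mem_shiftGraph_iff.1 hxy
    change ψ x = φ (μ • x - A ⟨x, hx⟩)
    rw [map_sub, ← h ⟨x, hx⟩]
    simp
  · intro h x
    have h1 := h x (shift A μ x) (mem_shiftGraph_iff.2 ⟨x.2, rfl⟩)
    change ψ x = φ (μ • (x : Y) - A x) at h1
    rw [sub_apply, h1]
    simp

theorem mem_eigenspace_dualOp_iff (hA : Dense (A.domain : Set Y)) {φ : StrongDual ℂ Y} :
    φ ∈ eigenspace (dualOp A) μ ↔ ∀ y ∈ shiftRange A μ, φ y = 0 := by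
  rw [mem_eigenspace_iff, mem_shiftGraph_dualOp_iff hA]
  simp only [mem_shiftRange_iff]
  exact ⟨fun h y ⟨x, hx⟩ => (h x y hx).symm, fun h x y hxy => (h y ⟨x, hxy⟩).symm⟩

/-- The map taking a bounded operator to its adjoint. -/
def adjointL (Y : Type*) [NormedAddCommGroup Y] [NormedSpace ℂ Y] :
    (Y →L[ℂ] Y) →L[ℂ] (StrongDual ℂ Y →L[ℂ] StrongDual ℂ Y) :=
  (ContinuousLinearMap.compL ℂ Y Y ℂ).flip

theorem adjointL_apply (T : Y →L[ℂ] Y) (φ : StrongDual ℂ Y) (y : Y) :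
    adjointL Y T φ y = φ (T y) := rfl

theorem IsResolventAt.adjointL (hA : Dense (A.domain : Set Y)) {R : Y →L[ℂ] Y}
    (h : IsResolventAt A μ R) : IsResolventAt (dualOp A) μ (adjointL Y R) := by
  refine isResolventAt_iff.2 ⟨fun ψ => ?_, fun φ ψ hφψ => ?_⟩
  · rw [mem_shiftGraph_dualOp_iff hA]
    intro x y hxy
    rw [adjointL_apply, h.apply_of_mem_shiftGraph hxy]
  · ext y
    rw [adjointL_apply]
    exact (mem_shiftGraph_dualOp_iff hA).1 hφψ _ _ (h.mem_shiftGraph y)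

/-- Taking adjoints is bounded and linear, so it preserves analyticity and commutes with the scalar
factor; and $R(z,A)'$ is the resolvent of $A'$. -/
theorem IsLaurent.adjointL (hA : Dense (A.domain : Set Y)) {M : ℕ} {g : ℂ → Y →L[ℂ] Y}
    (h : IsLaurent A μ M g) :
    IsLaurent (dualOp A) μ M fun z => StrongProjections.adjointL Y (g z) := by
  have hL : AnalyticAt ℂ (StrongProjections.adjointL Y) (g μ) :=
    ContinuousLinearMap.analyticAt _ _
  refine ⟨AnalyticAt.comp hL h.analyticAt, ?_, ?_⟩
  · filter_upwards [h.eventually_mem] with z hz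
    exact ⟨_, (isResolventAt_opResolvent hz).adjointL hA⟩
  · filter_upwards [h.eventually_mem, h.eventually_eq] with z hz hz2
    rw [((isResolventAt_opResolvent hz).adjointL hA).opResolvent_eq, hz2, map_smul]

end Dual

/-! ### Real and imaginary parts -/

section RealLattice

variable {X : Type*} [NormedAddCommGroup X] [Lattice X] [HasSolidNorm X]
  [IsOrderedAddMonoid X] [NormedSpace ℝ X] [IsOrderedModule ℝ X]

theorem cos_sin_le_modulus [CompleteSpace X] (x y : X) (θ : ℝ) :
    Real.cos θ • x + Real.sin θ • y ≤ modulus x y :=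
  (isLUB_modulus x y).1 ⟨θ, rfl⟩

theorem abs_fst_le_modulus [CompleteSpace X] (x y : X) : |x| ≤ modulus x y :=
  abs_le'.2 ⟨by simpa using cos_sin_le_modulus x y 0,
    by simpa using cos_sin_le_modulus x y Real.pi⟩

theorem abs_snd_le_modulus [CompleteSpace X] (x y : X) : |y| ≤ modulus x y :=
  abs_le'.2 ⟨by simpa using cos_sin_le_modulus x y (Real.pi / 2),
    by simpa using cos_sin_le_modulus x y (-(Real.pi / 2))⟩

theorem modulus_le_abs_add_abs [CompleteSpace X] (x y : X) : modulus x y ≤ |x| + |y| := by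
  refine (isLUB_modulus x y).2 ?_
  rintro _ ⟨θ, rfl⟩
  have h1 := smul_le_smul_abs (Real.abs_cos_le_one θ) x
  have h2 := smul_le_smul_abs (Real.abs_sin_le_one θ) y
  rw [one_smul] at h1 h2
  exact add_le_add h1 h2

theorem modulus_zero_right [CompleteSpace X] (x : X) : modulus x 0 = |x| :=
  le_antisymm (by simpa using modulus_le_abs_add_abs x 0) (abs_fst_le_modulus x 0)

omit [IsOrderedAddMonoid X] [NormedSpace ℝ X] [IsOrderedModule ℝ X] in
theorem norm_le_norm_of_abs_le {x y : X} (h : |x| ≤ y) : ‖x‖ ≤ ‖y‖ :=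
  norm_le_norm_of_abs_le_abs (h.trans (le_abs_self y))

omit [HasSolidNorm X] [NormedSpace ℝ X] [IsOrderedModule ℝ X] in
theorem eq_zero_of_abs_nonpos {x : X} (h : |x| ≤ 0) : x = 0 :=
  le_antisymm ((le_abs_self x).trans h) (neg_nonpos.1 ((neg_le_abs x).trans h))

omit [NormedSpace ℝ X] [IsOrderedModule ℝ X] in
theorem continuous_lattice_abs : Continuous fun x : X => |x| := continuous_id.sup continuous_neg

omit [HasSolidNorm X] in
theorem abs_real_smul (c : ℝ) (x : X) : |c • x| ≤ |c| • |x| := by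
  have h : ∀ c : ℝ, c • x ≤ |c| • |x| := fun c => smul_le_smul_abs le_rfl x
  refine abs_le'.2 ⟨h c, ?_⟩
  simpa using h (-c)

omit [HasSolidNorm X] in
theorem smul_inf_eq_zero {u v : X} (hu : 0 ≤ u) (hv : 0 ≤ v) (huv : u ⊓ v = 0) {c : ℝ}
    (hc : 0 ≤ c) : c • u ⊓ v = 0 := by
  -- The constant $d = c+1$ dominates both $c$ and $1$ and is invertible, so $cu\wedge v \le
  -- d(u\wedge v) = 0$.
  refine le_antisymm ?_ (le_inf (smul_nonneg hc hu) hv)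
  set d := c + 1
  have hd : 0 < d := by positivity
  have h1 : c • u ⊓ v ≤ d • u :=
    inf_le_left.trans (smul_le_smul_of_nonneg_right (by simp [d]) hu)
  have h2 : c • u ⊓ v ≤ d • v := by
    refine inf_le_right.trans ?_
    simpa using smul_le_smul_of_nonneg_right (show (1 : ℝ) ≤ d by simp [d, hc]) hv
  have h3 : d⁻¹ • (c • u ⊓ v) ≤ u ⊓ v :=
    le_inf ((inv_smul_le_iff_of_pos hd).2 h1) ((inv_smul_le_iff_of_pos hd).2 h2)
  rw [huv] at h3
  simpa using (inv_smul_le_iff_of_pos hd).1 h3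

/-- A totally ordered subspace of a real Banach lattice is spanned by each of its nonzero positive
elements. -/
theorem exists_eq_smul_of_total (S : Submodule ℝ X) (hS : ∀ x ∈ S, 0 ≤ x ∨ x ≤ 0) {u : X}
    (huS : u ∈ S) (hu : 0 ≤ u) (hu0 : u ≠ 0) {x : X} (hx : x ∈ S) : ∃ c : ℝ, x = c • u := by
  have hcmp : ∀ c : ℝ, c • u ≤ x ∨ x ≤ c • u := by
    intro c
    rcases hS _ (S.sub_mem hx (S.smul_mem c huS)) with h | h
    · exact Or.inl (sub_nonneg.1 h)
    · exact Or.inr (sub_nonpos.1 h)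
  have hun : 0 < ‖u‖ := norm_pos_iff.2 hu0
  -- Chosen so that $\|du\| = \|x\|+1 > \|x\|$, which rules out $du \le \pm x$.
  set d : ℝ := (‖x‖ + 1) / ‖u‖ with hd
  have hd0 : 0 ≤ d := by positivity
  have hdu : 0 ≤ d • u := smul_nonneg hd0 hu
  have hbig : ∀ y : X, ‖y‖ = ‖x‖ → ¬ d • u ≤ y := by
    intro y hy h
    have h1 : ‖d • u‖ ≤ ‖y‖ := norm_le_norm_of_abs_le (by rwa [abs_of_nonneg hdu])
    rw [norm_smul, Real.norm_of_nonneg hd0, hd, div_mul_cancel₀ _ hun.ne', hy] at h1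
    linarith
  have hne1 : x ≤ d • u := (hcmp d).resolve_left (hbig x rfl)
  have hne2 : (-d) • u ≤ x := by
    refine (hcmp (-d)).resolve_right fun h => hbig (-x) (norm_neg x) ?_
    rw [neg_smul] at h
    exact le_neg_of_le_neg h
  have hcont : Continuous fun c : ℝ => c • u := by fun_prop
  -- The two nonempty closed sets of scalars cover the connected line, hence meet.
  obtain ⟨c, -, h1, h2⟩ := isPreconnected_closed_iff.1 (isPreconnected_univ (α := ℝ))
    {c | c • u ≤ x} {c | x ≤ c • u} (isClosed_le hcont continuous_const)
    (isClosed_le continuous_const hcont) (fun c _ => hcmp c) ⟨_, trivial, hne2⟩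
    ⟨_, trivial, hne1⟩
  exact ⟨c, le_antisymm h2 h1⟩

/-- Solid subspaces of a real Banach lattice. -/
def IsSolidSubmodule (I : Submodule ℝ X) : Prop := ∀ x y : X, |x| ≤ |y| → y ∈ I → x ∈ I

omit [IsOrderedModule ℝ X] in
theorem IsSolidSubmodule.topologicalClosure {I : Submodule ℝ X} (hI : IsSolidSubmodule I) :
    IsSolidSubmodule I.topologicalClosure := by
  intro x y hxy hy
  -- Truncating $x$ to the order interval $[-|z|,|z|]$ is continuous in $z$, lands in $I$ for $z\in
  -- I$ by solidity, and returns $x$ at $z=y$.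
  have hf : Continuous fun z : X => (x ⊓ |z|) ⊔ -|z| :=
    (continuous_const.inf continuous_lattice_abs).sup continuous_lattice_abs.neg
  have h1 : (x ⊓ |y|) ⊔ -|y| = x := by
    rw [inf_eq_left.2 ((le_abs_self x).trans hxy), sup_eq_left]
    exact (neg_le_neg hxy).trans (neg_le.1 (neg_le_abs x))
  have h2 := map_mem_closure hf (s := (I : Set X)) (t := (I : Set X)) hy ?_
  · rwa [h1] at h2
  · intro z hz
    refine hI _ z (abs_le'.2 ⟨sup_le inf_le_right ?_, ?_⟩) hz
    · exact (neg_nonpos.2 (abs_nonneg z)).trans (abs_nonneg z)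
    · exact neg_le.1 le_sup_right

/-- The principal ideal generated by `u ≥ 0` in a real Banach lattice. -/
def realIdeal (u : X) (_hu : 0 ≤ u) : Submodule ℝ X where
  carrier := {x | ∃ c : ℝ, 0 ≤ c ∧ |x| ≤ c • u}
  zero_mem' := ⟨0, le_rfl, by simp⟩
  add_mem' := by
    rintro x y ⟨c, hc, hx⟩ ⟨d, hd, hy⟩
    refine ⟨c + d, by positivity, (abs_add_le x y).trans ?_⟩
    rw [add_smul]
    exact add_le_add hx hy
  smul_mem' := by
    rintro a x ⟨c, hc, hx⟩
    refine ⟨|a| * c, by positivity, (abs_real_smul a x).trans ?_⟩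
    rw [mul_smul]
    exact smul_le_smul_of_nonneg_left hx (abs_nonneg a)

omit [HasSolidNorm X] in
theorem isSolidSubmodule_realIdeal (u : X) (hu : 0 ≤ u) : IsSolidSubmodule (realIdeal u hu) := by
  rintro x y hxy ⟨c, hc, hy⟩
  exact ⟨c, hc, hxy.trans hy⟩

end RealLattice

/-! ### Passing between the complex Banach lattice and its real part -/

section Complexification

variable (X : Type*) {E : Type*} [NormedAddCommGroup X] [Lattice X] [HasSolidNorm X]
  [IsOrderedAddMonoid X] [NormedSpace ℝ X] [IsOrderedModule ℝ X] [CompleteSpace X]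
  [NormedAddCommGroup E] [NormedSpace ℂ E] [ComplexBanachLattice X E]

theorem norm_absVal (z : E) : ‖absVal X z‖ = ‖z‖ := (ComplexBanachLattice.norm_eq z).symm

/-- The real part, as a bounded real linear map. -/
def reL : E →L[ℝ] X :=
  LinearMap.mkContinuous
    ((LinearMap.fst ℝ X X).comp (ComplexBanachLattice.toProd (X := X) (E := E)).toLinearMap) 1
    fun z => by
      rw [one_mul, ← norm_absVal X z]
      exact norm_le_norm_of_abs_le (abs_fst_le_modulus _ _)

/-- The imaginary part, as a bounded real linear map. -/
def imL : E →L[ℝ] X :=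
  LinearMap.mkContinuous
    ((LinearMap.snd ℝ X X).comp (ComplexBanachLattice.toProd (X := X) (E := E)).toLinearMap) 1
    fun z => by
      rw [one_mul, ← norm_absVal X z]
      exact norm_le_norm_of_abs_le (abs_snd_le_modulus _ _)

theorem absVal_eq_modulus (z : E) : absVal X z = modulus (reL X z) (imL X z) := rfl

theorem toProd_ofReal (x : X) :
    ComplexBanachLattice.toProd (X := X) (ofReal x : E) = (x, 0) :=
  LinearEquiv.apply_symm_apply _ _

@[simp] theorem reL_ofReal (x : X) : reL X (ofReal x : E) = x :=
  congrArg Prod.fst (toProd_ofReal (E := E) X x)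

@[simp] theorem imL_ofReal (x : X) : imL X (ofReal x : E) = 0 :=
  congrArg Prod.snd (toProd_ofReal (E := E) X x)

@[simp] theorem reL_I_smul (z : E) : reL X (Complex.I • z) = -imL X z :=
  congrArg Prod.fst (ComplexBanachLattice.toProd_I_smul (X := X) z)

@[simp] theorem imL_I_smul (z : E) : imL X (Complex.I • z) = reL X z :=
  congrArg Prod.snd (ComplexBanachLattice.toProd_I_smul (X := X) z)

variable {X} in
theorem ext_re_im {z w : E} (h1 : reL X z = reL X w) (h2 : imL X z = imL X w) : z = w :=
  (ComplexBanachLattice.toProd (X := X)).injective (Prod.ext h1 h2)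

theorem absVal_ofReal (x : X) : absVal X (ofReal x : E) = |x| := by
  rw [absVal_eq_modulus, reL_ofReal, imL_ofReal, modulus_zero_right]

/-- The embedding of the real part, as a bounded real linear map. -/
def ofRealL (E : Type*) [NormedAddCommGroup E] [NormedSpace ℂ E] [ComplexBanachLattice X E] :
    X →L[ℝ] E :=
  LinearMap.mkContinuous
    ((ComplexBanachLattice.toProd (X := X) (E := E)).symm.toLinearMap.comp (LinearMap.inl ℝ X X)) 1
    fun x => by
      change ‖(ofReal x : E)‖ ≤ 1 * ‖x‖
      rw [← norm_absVal X, absVal_ofReal, norm_abs_eq_norm, one_mul]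

@[simp] theorem ofRealL_apply (x : X) : ofRealL X E x = ofReal x := rfl

variable {X}

theorem ofReal_sub (x y : X) : (ofReal (x - y) : E) = ofReal x - ofReal y :=
  map_sub (ofRealL X E) x y

@[simp] theorem ofReal_zero : (ofReal (0 : X) : E) = 0 := map_zero (ofRealL X E)

theorem ofReal_smul (c : ℝ) (x : X) : (ofReal (c • x) : E) = (c : ℂ) • ofReal x := by
  rw [Complex.coe_smul]
  exact map_smul (ofRealL X E) c x

theorem ofReal_injective : Function.Injective (ofReal : X → E) := fun x y h => by
  simpa using congrArg (reL X) h

@[simp] theorem ofReal_inj {x y : X} : (ofReal x : E) = ofReal y ↔ x = y :=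
  ofReal_injective.eq_iff

@[simp] theorem ofReal_eq_zero {x : X} : (ofReal x : E) = 0 ↔ x = 0 := by
  rw [← ofReal_zero (X := X), ofReal_inj]

theorem eq_ofReal_add (z : E) : z = ofReal (reL X z) + Complex.I • ofReal (imL X z) :=
  ext_re_im (X := X) (by simp) (by simp)

theorem complex_smul_eq (c : ℂ) (z : E) : c • z = c.re • z + c.im • (Complex.I • z) := by
  rw [← Complex.coe_smul, ← Complex.coe_smul, smul_smul, ← add_smul, Complex.re_add_im]

theorem reL_smul (c : ℂ) (z : E) : reL X (c • z) = c.re • reL X z - c.im • imL X z := by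
  rw [complex_smul_eq, map_add, map_smul, map_smul, reL_I_smul, smul_neg, sub_eq_add_neg]

theorem imL_smul (c : ℂ) (z : E) : imL X (c • z) = c.re • imL X z + c.im • reL X z := by
  rw [complex_smul_eq, map_add, map_smul, map_smul, imL_I_smul]

theorem isPos_ofReal {x : X} : IsPos X (ofReal x : E) ↔ 0 ≤ x := by
  constructor
  · rintro ⟨y, hy, h⟩
    rwa [ofReal_injective h]
  · exact fun h => ⟨x, h, rfl⟩

theorem exists_isPos_ne_zero {z : E} (hz : z ≠ 0) : ∃ x : X, 0 ≤ x ∧ x ≠ 0 := by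
  by_contra! h
  exact hz (ext_re_im (X := X) (by simpa using eq_zero_of_abs_nonpos (h _ (abs_nonneg (reL X z))).le)
    (by simpa using eq_zero_of_abs_nonpos (h _ (abs_nonneg (imL X z))).le))

theorem isQuasiInterior_ofReal {u : X} :
    IsQuasiInterior X (ofReal u : E) ↔ 0 ≤ u ∧ Dense (principalIdeal E u) := by
  constructor
  · rintro ⟨v, hv, h, hd⟩
    obtain rfl := ofReal_injective h
    exact ⟨hv, hd⟩
  · exact fun h => ⟨u, h.1, rfl, h.2⟩

/-- The continuous map $z\mapsto|\operatorname{Re} z|\wedge v$ vanishes on $E_u$, hence by density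
everywhere, and its value at $v$ is $v$. -/
theorem eq_zero_of_inf_eq_zero {u v : X} (hu : IsQuasiInterior X (ofReal u : E)) (hv : 0 ≤ v)
    (huv : u ⊓ v = 0) : v = 0 := by
  obtain ⟨hu0, hd⟩ := isQuasiInterior_ofReal.1 hu
  have hf : Continuous fun z : E => |reL X z| ⊓ v :=
    (continuous_lattice_abs.comp (reL X).continuous).inf continuous_const
  have h0 : Set.EqOn (fun z : E => |reL X z| ⊓ v) (fun _ => 0) (principalIdeal E u) := by
    rintro z ⟨c, hc, hz⟩
    refine le_antisymm ?_ (le_inf (abs_nonneg _) hv)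
    rw [← smul_inf_eq_zero hu0 hv huv hc]
    exact inf_le_inf_right v ((abs_fst_le_modulus _ _).trans hz)
  have := congrFun (Continuous.ext_on hd hf continuous_const h0) (ofReal v)
  simpa [abs_of_nonneg hv] using this

theorem IsQuasiInterior.ne_zero {u z : E} (hu : IsQuasiInterior X u) (hz : z ≠ 0) : u ≠ 0 := by
  rintro rfl
  obtain ⟨v, hv, hv0⟩ := exists_isPos_ne_zero (X := X) hz
  rw [← ofReal_zero (X := X)] at hu
  exact hv0 (eq_zero_of_inf_eq_zero hu hv (inf_eq_left.2 hv))

theorem isQuasiInterior_of_closure_eq_top {u : X} (hu : 0 ≤ u)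
    (h : (realIdeal u hu).topologicalClosure = ⊤) : IsQuasiInterior X (ofReal u : E) := by
  refine isQuasiInterior_ofReal.2 ⟨hu, fun z => ?_⟩
  have hmem : ∀ x : X, x ∈ closure (realIdeal u hu : Set X) := fun x => by
    have : x ∈ (realIdeal u hu).topologicalClosure := h ▸ Submodule.mem_top
    exact this
  have hf : Continuous fun p : X × X => ofRealL X E p.1 + Complex.I • ofRealL X E p.2 := by
    fun_prop
  have h1 : (reL X z, imL X z) ∈
      closure ((realIdeal u hu : Set X) ×ˢ (realIdeal u hu : Set X)) := by
    rw [closure_prod_eq]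
    exact ⟨hmem _, hmem _⟩
  have h2 := map_mem_closure hf h1 (t := principalIdeal E u) ?_
  · simpa [← eq_ofReal_add] using h2
  · rintro ⟨x, y⟩ ⟨⟨c, hc, hx⟩, d, hd, hy⟩
    refine ⟨c + d, by positivity, ?_⟩
    rw [absVal_eq_modulus]
    refine (modulus_le_abs_add_abs _ _).trans ?_
    rw [add_smul]
    refine add_le_add ?_ ?_ <;> simpa

/-- The subspace `I + i I` of `E`. -/
def complexify (E : Type*) [NormedAddCommGroup E] [NormedSpace ℂ E] [ComplexBanachLattice X E]
    (I : Submodule ℝ X) : Submodule ℂ E where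
  carrier := {z | reL X z ∈ I ∧ imL X z ∈ I}
  zero_mem' := by simp
  add_mem' := by
    rintro z w ⟨hz, hz'⟩ ⟨hw, hw'⟩
    exact ⟨by simpa using I.add_mem hz hw, by simpa using I.add_mem hz' hw'⟩
  smul_mem' := by
    rintro c z ⟨hz, hz'⟩
    refine ⟨?_, ?_⟩
    · rw [reL_smul]
      exact I.sub_mem (I.smul_mem _ hz) (I.smul_mem _ hz')
    · rw [imL_smul]
      exact I.add_mem (I.smul_mem _ hz') (I.smul_mem _ hz)

theorem mem_complexify {I : Submodule ℝ X} {z : E} :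
    z ∈ complexify E I ↔ reL X z ∈ I ∧ imL X z ∈ I := Iff.rfl

theorem ofReal_mem_complexify {I : Submodule ℝ X} {x : X} :
    (ofReal x : E) ∈ complexify E I ↔ x ∈ I := by
  simp [mem_complexify]

theorem isClosed_complexify {I : Submodule ℝ X} (hI : IsClosed (I : Set X)) :
    IsClosed (complexify E I : Set E) :=
  (hI.preimage (reL X).continuous).inter (hI.preimage (imL X).continuous)

theorem isLatticeIdeal_complexify {I : Submodule ℝ X} (hI : IsSolidSubmodule I) :
    IsLatticeIdeal X (complexify E I) := by
  intro f g hfg hg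
  have habs : ∀ x ∈ I, |x| ∈ I := fun x hx => hI _ x (by rw [abs_abs]) hx
  have hm : |reL X g| + |imL X g| ∈ I := I.add_mem (habs _ hg.1) (habs _ hg.2)
  have hle : absVal X f ≤ |(|reL X g| + |imL X g|)| :=
    (hfg.trans (modulus_le_abs_add_abs _ _)).trans (le_abs_self _)
  exact ⟨hI _ _ ((abs_fst_le_modulus _ _).trans hle) hm,
    hI _ _ ((abs_snd_le_modulus _ _).trans hle) hm⟩

/-! ### Positive operators -/

variable (X) in
/-- The restriction of an operator to the real part, followed by taking real parts. -/
def realPart (T : E →L[ℂ] E) : X →L[ℝ] X :=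
  (reL X).comp ((T.restrictScalars ℝ).comp (ofRealL X E))

theorem realPart_apply (T : E →L[ℂ] E) (x : X) : realPart X T x = reL X (T (ofReal x)) := rfl

/-- Positivity makes $T$ real, by splitting $x = x^+ - x^-$. Arguments about $T$ can therefore be
carried out in the real lattice. -/
theorem IsPosOp.apply_ofReal {T : E →L[ℂ] E} (hT : IsPosOp X T) (x : X) :
    T (ofReal x) = ofReal (realPart X T x) := by
  have h : ∀ y : X, 0 ≤ y → imL X (T (ofReal y)) = 0 := by
    intro y hy
    obtain ⟨w, -, hw⟩ := hT _ (isPos_ofReal.2 hy)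
    rw [hw, imL_ofReal]
  refine ext_re_im (X := X) (by simp [realPart_apply]) ?_
  rw [imL_ofReal, ← posPart_sub_negPart x, ofReal_sub, map_sub, map_sub, h _ (posPart_nonneg x),
    h _ (negPart_nonneg x), sub_zero]

theorem IsPosOp.realPart_nonneg {T : E →L[ℂ] E} (hT : IsPosOp X T) {x : X} (hx : 0 ≤ x) :
    0 ≤ realPart X T x := by
  have := hT _ (isPos_ofReal.2 hx)
  rwa [hT.apply_ofReal, isPos_ofReal] at this

theorem IsPosOp.realPart_mono {T : E →L[ℂ] E} (hT : IsPosOp X T) {x y : X} (h : x ≤ y) :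
    realPart X T x ≤ realPart X T y := by
  have := hT.realPart_nonneg (sub_nonneg.2 h)
  rwa [map_sub, sub_nonneg] at this

theorem IsPosOp.abs_realPart_le {T : E →L[ℂ] E} (hT : IsPosOp X T) (x : X) :
    |realPart X T x| ≤ realPart X T |x| := by
  refine abs_le'.2 ⟨hT.realPart_mono (le_abs_self x), ?_⟩
  rw [← map_neg]
  exact hT.realPart_mono (neg_le_abs x)

theorem IsPosOp.apply_eq {T : E →L[ℂ] E} (hT : IsPosOp X T) (z : E) :
    T z = ofReal (realPart X T (reL X z)) + Complex.I • ofReal (realPart X T (imL X z)) := by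
  conv_lhs => rw [eq_ofReal_add (X := X) z]
  rw [map_add, map_smul, hT.apply_ofReal, hT.apply_ofReal]

/-- Irreducibility is applied to $I + iI$, which inherits closedness, solidity and invariance from
$I$. -/
theorem IsIrreducibleOp.real {T : E →L[ℂ] E} (h : IsIrreducibleOp X T) (hT : IsPosOp X T)
    {I : Submodule ℝ X} (hI : IsClosed (I : Set X)) (hs : IsSolidSubmodule I)
    (hinv : ∀ x ∈ I, realPart X T x ∈ I) : I = ⊥ ∨ I = ⊤ := by
  refine (h (complexify E I) (isClosed_complexify hI) (isLatticeIdeal_complexify hs) ?_).imp ?_ ?_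
  · intro f hf
    rw [hT.apply_eq]
    exact (complexify E I).add_mem (ofReal_mem_complexify.2 (hinv _ hf.1))
      ((complexify E I).smul_mem _ (ofReal_mem_complexify.2 (hinv _ hf.2)))
  · intro hJ
    refine (Submodule.eq_bot_iff _).2 fun x hx => ?_
    have : (ofReal x : E) ∈ complexify E I := ofReal_mem_complexify.2 hx
    rw [hJ] at this
    simpa using this
  · intro hJ
    refine (Submodule.eq_top_iff').2 fun x => ?_
    rw [← ofReal_mem_complexify (E := E), hJ]
    exact Submodule.mem_top

theorem IsStronglyPosOp.isPosOp {T : E →L[ℂ] E} (hT : IsStronglyPosOp X T) : IsPosOp X T := by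
  intro f hf
  by_cases h0 : f = 0
  · rw [h0, map_zero]
    exact ⟨0, le_rfl, by simp⟩
  · obtain ⟨u, hu, h, -⟩ := hT f hf h0
    exact ⟨u, hu, h⟩

/-- A strongly positive operator is irreducible. -/
theorem IsStronglyPosOp.isIrreducibleOp {T : E →L[ℂ] E} (hT : IsStronglyPosOp X T) :
    IsIrreducibleOp X T := by
  intro J hJc hJs hJT
  by_contra! hne
  obtain ⟨z, hz, hz0⟩ := (Submodule.ne_bot_iff J).1 hne.1
  have hpos : 0 ≤ absVal X z := (abs_nonneg _).trans (abs_fst_le_modulus _ _)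
  have hmem : (ofReal (absVal X z) : E) ∈ J := by
    refine hJs _ z ?_ hz
    rw [absVal_ofReal, abs_of_nonneg hpos]
  have hne0 : (ofReal (absVal X z) : E) ≠ 0 := by
    intro h
    rw [ofReal_eq_zero] at h
    have := norm_absVal X z
    rw [h, norm_zero] at this
    exact hz0 (norm_eq_zero.1 this.symm)
  -- The ideal $J$ contains $|z|$, hence $u = T|z|$, hence the dense set $E_u$.
  obtain ⟨u, hu, hTu, hd⟩ := hT _ (isPos_ofReal.2 hpos) hne0
  have huJ : (ofReal u : E) ∈ J := hTu ▸ hJT _ hmem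
  have hsub : principalIdeal E u ⊆ (J : Set E) := by
    rintro f ⟨c, hc, hf⟩
    refine hJs f ((c : ℂ) • ofReal u) ?_ (J.smul_mem _ huJ)
    rwa [← ofReal_smul, absVal_ofReal, abs_of_nonneg (smul_nonneg hc hu)]
  apply hne.2
  have h1 : closure (J : Set E) = Set.univ := (hd.mono hsub).closure_eq
  rw [hJc.closure_eq] at h1
  exact SetLike.coe_injective h1

/-- A nonzero positive irreducible projection is strongly positive. -/
theorem IsIrreducibleOp.isStronglyPosOp {T : E →L[ℂ] E} (h : IsIrreducibleOp X T)
    (hT : IsPosOp X T) (hidem : ∀ z, T (T z) = T z) (hT0 : T ≠ 0) : IsStronglyPosOp X T := by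
  rintro _ ⟨x, hx, rfl⟩ hx0
  rw [Ne, ofReal_eq_zero] at hx0
  set p := realPart X T with hp
  have hpp : ∀ y, p (p y) = p y := by
    intro y
    have := hidem (ofReal y)
    rwa [hT.apply_ofReal, hT.apply_ofReal, ofReal_inj] at this
  have hpx : p x ≠ 0 := by
    intro h0
    -- The null ideal of $p$ is closed, solid and trivially invariant. It is not the whole space
    -- because $T\ne 0$, so irreducibility makes it zero.
    let N : Submodule ℝ X :=
      { carrier := {y | p |y| = 0}
        zero_mem' := by simp
        add_mem' := by
          intro y w hy hw
          refine le_antisymm ?_ (hT.realPart_nonneg (abs_nonneg _))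
          have := hT.realPart_mono (abs_add_le y w)
          rwa [map_add, ← hp, show p |y| = 0 from hy, show p |w| = 0 from hw, add_zero] at this
        smul_mem' := by
          intro c y hy
          refine le_antisymm ?_ (hT.realPart_nonneg (abs_nonneg _))
          have := hT.realPart_mono (abs_real_smul c y)
          rwa [map_smul, ← hp, show p |y| = 0 from hy, smul_zero] at this }
    have hclosed : IsClosed (N : Set X) :=
      isClosed_eq (f := fun y : X => p |y|) (p.continuous.comp continuous_lattice_abs) continuous_const
    have hsolid : IsSolidSubmodule N := by
      intro y w hyw hw
      refine le_antisymm ?_ (hT.realPart_nonneg (abs_nonneg _))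
      exact (hT.realPart_mono hyw).trans_eq hw
    have hzero : ∀ y ∈ N, p y = 0 := by
      intro y hy
      have h1 := hT.abs_realPart_le y
      rw [← hp, show p |y| = 0 from hy] at h1
      exact eq_zero_of_abs_nonpos h1
    have hinv : ∀ y ∈ N, p y ∈ N := by
      intro y hy
      rw [hzero y hy]
      exact N.zero_mem
    rcases h.real hT hclosed hsolid hinv with hN | hN
    · have : x ∈ N := by
        change p |x| = 0
        rwa [abs_of_nonneg hx]
      rw [hN] at this
      exact hx0 this
    · apply hT0
      ext z
      have hall : ∀ y, p y = 0 := fun y => hzero y (hN ▸ Submodule.mem_top)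
      rw [hT.apply_eq, ← hp, hall, hall]
      simp
  have hpx0 : 0 ≤ p x := hT.realPart_nonneg hx
  rw [hT.apply_ofReal]
  refine isQuasiInterior_of_closure_eq_top hpx0 ?_
  -- Idempotence enters here: $|y|\le c\,px$ gives $|py|\le c\,p(px) = c\,px$.
  have hinv : ∀ y ∈ realIdeal (p x) hpx0, p y ∈ realIdeal (p x) hpx0 := by
    rintro y ⟨c, hc, hy⟩
    refine ⟨c, hc, (hT.abs_realPart_le y).trans ?_⟩
    have := hT.realPart_mono hy
    rwa [map_smul, ← hp, hpp] at this
  rcases h.real hT (Submodule.isClosed_topologicalClosure _)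
      (isSolidSubmodule_realIdeal (p x) hpx0).topologicalClosure
      (fun y hy => map_mem_closure p.continuous hy hinv) with h1 | h1
  · exfalso
    have hmem : p x ∈ (realIdeal (p x) hpx0).topologicalClosure :=
      Submodule.le_topologicalClosure _ ⟨1, zero_le_one, by rw [one_smul, abs_of_nonneg hpx0]⟩
    rw [h1] at hmem
    exact hpx hmem
  · exact h1

/-- The range of a strongly positive projection is spanned by a quasi-interior point. -/
theorem IsStronglyPosOp.exists_range_eq_span {T : E →L[ℂ] E} (h : IsStronglyPosOp X T)
    (hidem : ∀ z, T (T z) = T z) {z : E} (hz : z ≠ 0) :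
    ∃ u : X, u ≠ 0 ∧ IsQuasiInterior X (ofReal u : E) ∧ T (ofReal u) = ofReal u ∧
      ∀ x : X, ∃ c : ℝ, T (ofReal x) = (c : ℂ) • ofReal u := by
  have hT := h.isPosOp
  set p := realPart X T with hp
  have hpp : ∀ y, p (p y) = p y := by
    intro y
    have := hidem (ofReal y)
    rwa [hT.apply_ofReal, hT.apply_ofReal, ofReal_inj] at this
  have hquasi : ∀ x : X, 0 ≤ x → x ≠ 0 → IsQuasiInterior X (ofReal (p x) : E) := by
    intro x hx hx0
    rw [← hT.apply_ofReal]
    exact h _ (isPos_ofReal.2 hx) (by simpa using hx0)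
  have hker : ∀ x : X, 0 ≤ x → p x = 0 → x = 0 := by
    intro x hx hpx
    by_contra hx0
    have := (hquasi x hx hx0).ne_zero hz
    rw [hpx] at this
    simp at this
  -- For a fixed $x$, $|x|\le p|x|$ and $p$ annihilates the positive difference, so $|x|$ and then
  -- $x^+$ are fixed. If $x^+\ne 0$, then $x^+ = px^+$ is quasi-interior and disjoint from $x^-$,
  -- forcing $x^-=0$.
  have htotal : ∀ x : X, p x = x → 0 ≤ x ∨ x ≤ 0 := by
    intro x hx
    have habs : p |x| = |x| := by
      have h1 := hT.abs_realPart_le x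
      rw [← hp, hx] at h1
      have h2 := hker (p |x| - |x|) (sub_nonneg.2 h1) (by rw [map_sub, hpp, sub_self])
      exact sub_eq_zero.1 h2
    have h2 : (2 : ℝ) • x⁺ = |x| + x := by
      have h3 := posPart_sub_negPart x
      have h4 := posPart_add_negPart x
      rw [two_smul]
      calc x⁺ + x⁺ = (x⁺ + x⁻) + (x⁺ - x⁻) := by abel
        _ = |x| + x := by rw [h3, h4]
    have hpos : p x⁺ = x⁺ := by
      have h3 : (2 : ℝ) • p x⁺ = (2 : ℝ) • x⁺ := by rw [← map_smul, h2, map_add, habs, hx]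
      exact smul_right_injective X (two_ne_zero' ℝ) h3
    by_cases hx0 : x⁺ = 0
    · exact Or.inr (posPart_eq_zero.1 hx0)
    · left
      have h4 := hquasi _ (posPart_nonneg x) hx0
      rw [hpos] at h4
      exact negPart_eq_zero.1
        (eq_zero_of_inf_eq_zero h4 (negPart_nonneg x) (posPart_inf_negPart_eq_zero x))
  obtain ⟨v, hv, hv0⟩ := exists_isPos_ne_zero (X := X) hz
  have hu0 : p v ≠ 0 := fun h0 => hv0 (hker v hv h0)
  refine ⟨p v, hu0, hquasi v hv hv0, by rw [hT.apply_ofReal, ← hp, hpp], fun x => ?_⟩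
  let S : Submodule ℝ X := LinearMap.eqLocus p.toLinearMap LinearMap.id
  obtain ⟨c, hc⟩ := exists_eq_smul_of_total S (fun x hx => htotal x hx) (u := p v) (hpp v)
    (hT.realPart_nonneg hv) hu0 (x := p x) (hpp x)
  exact ⟨c, by rw [hT.apply_ofReal, ← hp, hc, ofReal_smul]⟩

end Complexification

/-! ### Order properties of the spectral projection and of the eigenvalue -/

section Equivalences

variable {X E : Type*} [NormedAddCommGroup X] [Lattice X] [HasSolidNorm X]
  [IsOrderedAddMonoid X] [NormedSpace ℝ X] [IsOrderedModule ℝ X] [CompleteSpace X]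
  [NormedAddCommGroup E] [NormedSpace ℂ E] [ComplexBanachLattice X E]
  {A : E →ₗ.[ℂ] E} {μ : ℂ}

theorem IsStrictlyPosFunctional.apply_ne_zero {φ : StrongDual ℂ E}
    (hφ : IsStrictlyPosFunctional X φ) {f : E} (hf : IsPos X f) (hf0 : f ≠ 0) : φ f ≠ 0 := by
  intro h
  have := (hφ f hf hf0).1
  rw [h] at this
  simp at this

theorem IsQuasiInterior.isPos {f : E} (hf : IsQuasiInterior X f) : IsPos X f := by
  obtain ⟨u, hu, h, -⟩ := hf
  exact ⟨u, hu, h⟩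

theorem isQuasiInterior_smul {v : X} (hv : IsQuasiInterior X (ofReal v : E)) {c : ℝ}
    (hc : 0 < c) : IsQuasiInterior X (ofReal (c • v) : E) := by
  obtain ⟨hv0, hd⟩ := isQuasiInterior_ofReal.1 hv
  refine isQuasiInterior_ofReal.2 ⟨smul_nonneg hc.le hv0, hd.mono ?_⟩
  rintro z ⟨d, hd, hz⟩
  refine ⟨d / c, by positivity, ?_⟩
  rwa [smul_smul, div_mul_cancel₀ _ hc.ne']

/-- For a real operator and a real number `l`, the real and imaginary parts of `(l - A) w` are
`(l - A)` applied to the real and imaginary parts of `w`. -/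
theorem IsRealOperator.imL_mem_shiftRange (hA : IsRealOperator X A) {l : ℝ} {y : E}
    (hy : y ∈ shiftRange A (l : ℂ)) : (ofReal (imL X y) : E) ∈ shiftRange A (l : ℂ) := by
  have hreal : ∀ a : X, (ofReal a : E) ∈ A.domain →
      ∃ a' : X, ((ofReal a : E), (ofReal a' : E)) ∈ shiftGraph A (l : ℂ) := by
    intro a ha
    obtain ⟨b, hb⟩ := hA.2 a ha
    refine ⟨l • a - b, mem_shiftGraph_iff.2 ⟨ha, ?_⟩⟩
    change (l : ℂ) • (ofReal a : E) - A ⟨ofReal a, ha⟩ = _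
    rw [hb, ofReal_sub, ofReal_smul]
  obtain ⟨w, hw⟩ := mem_shiftRange_iff.1 hy
  have hwd : w ∈ (A.domain : Set E) := (mem_shiftGraph_iff.1 hw).1
  rw [hA.1] at hwd
  obtain ⟨a, b, ha, hb, rfl⟩ := hwd
  obtain ⟨a', ha'⟩ := hreal a ha
  obtain ⟨b', hb'⟩ := hreal b hb
  have h1 := (shiftGraph A (l : ℂ)).add_mem ha' ((shiftGraph A (l : ℂ)).smul_mem Complex.I hb')
  obtain ⟨_, hw'⟩ := mem_shiftGraph_iff.1 hw
  obtain ⟨_, h1'⟩ := mem_shiftGraph_iff.1 h1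
  have e : y = ofReal a' + Complex.I • ofReal b' := hw'.symm.trans h1'
  have e2 : imL X y = b' := by rw [e]; simp
  rw [e2]
  exact mem_shiftRange_iff.2 ⟨_, hb'⟩

variable [CompleteSpace E]

theorem spectralProjection_ne_zero (hpole : IsResolventPole A μ) (heig : IsEigenvalue A μ) :
    spectralProjection A μ ≠ 0 := by
  obtain ⟨w, hw, hw0⟩ := (Submodule.ne_bot_iff _).1 heig
  intro h
  have := spectralProjection_apply_of_mem_eigenspace hpole hw
  rw [h] at this
  exact hw0 this.symm

/-- A strongly positive spectral projection has the form `f ↦ ⟨φ, f⟩ u`, with a quasi-interior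
eigenvector `u` and a strictly positive functional `φ`. -/
theorem IsStronglyPosOp.exists_eigenvector (hA : A.IsClosed) (hpole : IsResolventPole A μ)
    (heig : IsEigenvalue A μ) (h : IsStronglyPosOp X (spectralProjection A μ)) :
    ∃ (u : E) (φ : StrongDual ℂ E), u ∈ eigenspace A μ ∧ IsQuasiInterior X u ∧ u ≠ 0 ∧
      IsStrictlyPosFunctional X φ ∧ ∀ z, spectralProjection A μ z = φ z • u := by
  obtain ⟨w, hw, hw0⟩ := (Submodule.ne_bot_iff _).1 heig
  have hidem := spectralProjection_idem hA hpole
  obtain ⟨v, hv0, hvq, hTv, hspan⟩ := h.exists_range_eq_span hidem hw0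
  have hu0 : (ofReal v : E) ≠ 0 := by simpa using hv0
  -- With $\psi(v)=1$, the functional $\psi\circ P$ reads off the coefficient of $Pz$ along $v$.
  obtain ⟨ψ, hψ⟩ := SeparatingDual.exists_eq_one (R := ℂ) hu0
  have hform : ∀ z, spectralProjection A μ z =
      (ψ.comp (spectralProjection A μ)) z • (ofReal v : E) := by
    intro z
    obtain ⟨a, ha⟩ := hspan (reL X z)
    obtain ⟨b, hb⟩ := hspan (imL X z)
    have e : spectralProjection A μ z = ((a : ℂ) + Complex.I * b) • (ofReal v : E) := by
      conv_lhs => rw [eq_ofReal_add (X := X) z]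
      rw [map_add, map_smul, ha, hb, add_smul, mul_smul]
    rw [ContinuousLinearMap.comp_apply, e, map_smul, hψ, smul_eq_mul, mul_one]
  refine ⟨ofReal v, ψ.comp (spectralProjection A μ), ?_, hvq, hu0, ?_, hform⟩
  · have h1 := hform w
    rw [spectralProjection_apply_of_mem_eigenspace hpole hw] at h1
    have hc : (ψ.comp (spectralProjection A μ)) w ≠ 0 := by
      intro h0
      rw [h0, zero_smul] at h1
      exact hw0 h1
    -- The known eigenvector $w = Pw$ is a nonzero multiple of $v$; rescaling shows that $v$ is an
    -- eigenvector, without assuming in advance that all of $\operatorname{im} P$ consists of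
    -- eigenvectors.
    have h2 := (eigenspace A μ).smul_mem ((ψ.comp (spectralProjection A μ)) w)⁻¹ hw
    rwa [h1, smul_smul, ← h1, inv_mul_cancel₀ hc, one_smul] at h2
  · rintro f hf hf0
    obtain ⟨x, hx, rfl⟩ := id hf
    obtain ⟨c, hc⟩ := hspan x
    have hval : (ψ.comp (spectralProjection A μ)) (ofReal x) = (c : ℂ) := by
      rw [ContinuousLinearMap.comp_apply, hc, map_smul, hψ, smul_eq_mul, mul_one]
    rw [hval, Complex.ofReal_re, Complex.ofReal_im]
    refine ⟨?_, rfl⟩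
    have hq := h _ hf hf0
    rw [hc, ← ofReal_smul] at hq
    by_contra! hc0
    have h1 : 0 ≤ c • v := isPos_ofReal.1 hq.isPos
    have h2 : c • v ≤ 0 :=
      smul_nonpos_of_nonpos_of_nonneg hc0 (isPos_ofReal.1 hvq.isPos)
    exact hq.ne_zero hw0 (by rw [le_antisymm h2 h1, ofReal_zero])

theorem functional_mem_eigenspace (hA : A.IsClosed)
    (hA_dense : Dense (A.domain : Set E)) (hpole : IsResolventPole A μ) {u : E}
    (hu : u ∈ eigenspace A μ) (hu0 : u ≠ 0) {φ : StrongDual ℂ E}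
    (hform : ∀ z, spectralProjection A μ z = φ z • u) : φ ∈ eigenspace (dualOp A) μ := by
  refine (mem_eigenspace_dualOp_iff hA_dense).2 fun y hy => ?_
  have h1 := spectralProjection_eq_zero_of_mem_shiftRange hA hpole
    (fun z => by rw [hform]; exact (eigenspace A μ).smul_mem _ hu) hy
  rw [hform] at h1
  exact (smul_eq_zero.1 h1).resolve_right hu0

theorem isGeometricallySimple_of_stronglyPos (hpole : IsResolventPole A μ) {u : E}
    (hu : u ∈ eigenspace A μ) (hu0 : u ≠ 0) {φ : StrongDual ℂ E}
    (hform : ∀ z, spectralProjection A μ z = φ z • u) : IsGeometricallySimple A μ := by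
  have h : eigenspace A μ = Submodule.span ℂ {u} := by
    refine le_antisymm (fun w hw => ?_) ((Submodule.span_singleton_le_iff_mem _ _).2 hu)
    rw [← spectralProjection_apply_of_mem_eigenspace hpole hw, hform]
    exact Submodule.smul_mem _ _ (Submodule.mem_span_singleton_self u)
  rw [IsGeometricallySimple, h]
  exact finrank_span_singleton hu0

-- A Jordan chain of length two would put a nonzero multiple of $u$ into $\operatorname{im}(\mu-A)$,
-- which $\varphi$ annihilates, although $\varphi(u)\ne 0$.
omit [CompleteSpace E] in
theorem genEigenspace_eq_eigenspace (hA_dense : Dense (A.domain : Set E))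
    (hgeo : IsGeometricallySimple A μ) {u : E} (hu : u ∈ eigenspace A μ) (hu0 : u ≠ 0)
    {φ : StrongDual ℂ E} (hφ : φ ∈ eigenspace (dualOp A) μ) (hφu : φ u ≠ 0) :
    genEigenspace A μ = eigenspace A μ := by
  refine le_antisymm (iSup_le fun n => ?_) (eigenspace_le_genEigenspace A μ)
  induction n with
  | zero => exact bot_le
  | succ n ih =>
    intro x hx
    obtain ⟨y, hy, hxy⟩ := mem_powerKer_succ_iff.1 hx
    obtain ⟨c, hc⟩ := (finrank_eq_one_iff_of_nonzero' (⟨u, hu⟩ : eigenspace A μ)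
      (by simpa using hu0)).1 hgeo ⟨y, ih hy⟩
    have hc' : c • u = y := congrArg Subtype.val hc
    have h1 := (mem_eigenspace_dualOp_iff hA_dense).1 hφ y (mem_shiftRange_iff.2 ⟨x, hxy⟩)
    rw [← hc', map_smul, smul_eq_mul] at h1
    have hc0 := (mul_eq_zero.1 h1).resolve_right hφu
    rw [← hc', hc0, zero_smul] at hxy
    exact mem_eigenspace_iff.2 hxy

omit [CompleteSpace E] in
theorem shiftRange_inter_posCone (hA_dense : Dense (A.domain : Set E)) {φ : StrongDual ℂ E}
    (hφ : φ ∈ eigenspace (dualOp A) μ) (hφpos : IsStrictlyPosFunctional X φ) :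
    (shiftRange A μ : Set E) ∩ posCone X E = {0} := by
  refine Set.Subset.antisymm ?_ ?_
  · rintro f ⟨hf, hfpos⟩
    by_contra hf0
    exact hφpos.apply_ne_zero hfpos hf0 ((mem_eigenspace_dualOp_iff hA_dense).1 hφ f hf)
  · rintro _ rfl
    exact ⟨(shiftRange A μ).zero_mem, 0, le_rfl, by simp⟩

/-- Algebraic simplicity gives $Px = cv$ for $x>0$, and $x - cv$ lies in
$\operatorname{im}(\lambda_0-A)$. The positivity of $c$ is extracted from the range condition, first
for the imaginary and then for the real part. -/
theorem isStronglyPosOp_of_algebraicallySimple (hA : A.IsClosed) (hreal : IsRealOperator X A)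
    {l : ℝ} (hpole : IsResolventPole A (l : ℂ)) (halg : IsAlgebraicallySimple A (l : ℂ)) {u : E}
    (hu : u ∈ eigenspace A (l : ℂ)) (huq : IsQuasiInterior X u)
    (hrange : (shiftRange A (l : ℂ) : Set E) ∩ posCone X E = {0}) :
    IsStronglyPosOp X (spectralProjection A (l : ℂ)) := by
  obtain ⟨w, -, hw0⟩ := (Submodule.ne_bot_iff _).1 halg.1
  have hu0 : u ≠ 0 := huq.ne_zero hw0
  obtain ⟨v, hv, rfl⟩ := huq.isPos
  have hzero : ∀ x : X, 0 ≤ x → (ofReal x : E) ∈ shiftRange A (l : ℂ) → x = 0 := by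
    intro x hx hxr
    have : (ofReal x : E) ∈ ({0} : Set E) := hrange ▸ ⟨hxr, x, hx, rfl⟩
    simpa using this
  have hv0 : v ≠ 0 := by simpa using hu0
  have hspan : ∀ z, ∃ c : ℂ, spectralProjection A (l : ℂ) z = c • (ofReal v : E) := by
    intro z
    obtain ⟨c, hc⟩ := (finrank_eq_one_iff_of_nonzero'
      (⟨ofReal v, eigenspace_le_genEigenspace A _ hu⟩ : genEigenspace A (l : ℂ))
      (by simpa using hv0)).1 halg.2 ⟨_, spectralProjection_mem_genEigenspace hA hpole z⟩
    exact ⟨c, (congrArg Subtype.val hc).symm⟩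
  rintro _ ⟨x, hx, rfl⟩ hx0
  obtain ⟨c, hc⟩ := hspan (ofReal x)
  have hmem := sub_spectralProjection_mem_shiftRange hA hpole (ofReal x)
  rw [hc] at hmem
  -- Since $A$ is real, the imaginary part $-(\operatorname{Im} c)v$ of $x-cv$ is again in the
  -- range; if $\operatorname{Im} c\ne 0$, then $v>0$ would be too.
  have him : c.im = 0 := by
    have h1 := hreal.imL_mem_shiftRange hmem
    rw [map_sub, imL_smul, imL_ofReal, imL_ofReal, reL_ofReal, smul_zero, zero_add, zero_sub,
      ← neg_smul, ofReal_smul] at h1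
    by_contra hne
    have h2 := (shiftRange A (l : ℂ)).smul_mem ((-c.im : ℝ) : ℂ)⁻¹ h1
    rw [smul_smul, inv_mul_cancel₀ (by simpa using hne), one_smul] at h2
    exact hv0 (hzero v hv h2)
  have hcre : c = (c.re : ℂ) := Complex.ext rfl (by simpa using him)
  rw [hcre, ← ofReal_smul, ← ofReal_sub] at hmem
  rw [hc, hcre, ← ofReal_smul]
  refine isQuasiInterior_smul huq ?_
  -- If $\operatorname{Re} c\le 0$, then $x-cv\ge x\ge 0$ lies in the range, so $x = cv\le 0$ and
  -- $x=0$.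
  by_contra! hneg
  have hcv : c.re • v ≤ 0 := smul_nonpos_of_nonpos_of_nonneg hneg hv
  have h3 := sub_eq_zero.1 (hzero _ (sub_nonneg.2 (hcv.trans hx)) hmem)
  exact hx0 (by rw [le_antisymm (h3.trans_le hcv) hx, ofReal_zero])

end Equivalences

end StrongProjections

end

/-! ### Assembly of the equivalences and their consequences -/

theorem mainTheorem4 {X E : Type*}
    [NormedAddCommGroup X] [Lattice X] [HasSolidNorm X] [IsOrderedAddMonoid X]
    [NormedSpace ℝ X] [IsOrderedModule ℝ X] [CompleteSpace X]
    [NormedAddCommGroup E] [NormedSpace ℂ E] [CompleteSpace E]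
    [StrongProjections.ComplexBanachLattice X E]
    (A : E →ₗ.[ℂ] E) (hA_closed : A.IsClosed) (hA_dense : Dense (A.domain : Set E))
    (hA_real : StrongProjections.IsRealOperator X A)
    (l₀ : ℝ) (hl_eig : StrongProjections.IsEigenvalue A (l₀ : ℂ))
    (hl_pole : StrongProjections.IsResolventPole A (l₀ : ℂ)) :
    List.TFAE [
      StrongProjections.IsPosOp X (StrongProjections.spectralProjection A (l₀ : ℂ)) ∧
        StrongProjections.IsIrreducibleOp X (StrongProjections.spectralProjection A (l₀ : ℂ)),
      StrongProjections.IsStronglyPosOp X (StrongProjections.spectralProjection A (l₀ : ℂ)),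
      StrongProjections.IsGeometricallySimple A (l₀ : ℂ) ∧
        (∃ u ∈ StrongProjections.eigenspace A (l₀ : ℂ),
          StrongProjections.IsQuasiInterior X u) ∧
        (∃ φ ∈ StrongProjections.eigenspace (StrongProjections.dualOp A) (l₀ : ℂ),
          StrongProjections.IsStrictlyPosFunctional X φ),
      StrongProjections.IsAlgebraicallySimple A (l₀ : ℂ) ∧
        (∃ u ∈ StrongProjections.eigenspace A (l₀ : ℂ),
          StrongProjections.IsQuasiInterior X u) ∧
        (StrongProjections.shiftRange A (l₀ : ℂ) : Set E) ∩ StrongProjections.posCone X E = {0}] ∧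
    (StrongProjections.IsPosOp X (StrongProjections.spectralProjection A (l₀ : ℂ)) ∧
        StrongProjections.IsIrreducibleOp X (StrongProjections.spectralProjection A (l₀ : ℂ)) →
      StrongProjections.IsSimpleResolventPole A (l₀ : ℂ) ∧
      StrongProjections.IsSimpleResolventPole (StrongProjections.dualOp A) (l₀ : ℂ) ∧
      ∀ μ : ℂ, (∃ u ∈ StrongProjections.eigenspace A μ, u ≠ 0 ∧ StrongProjections.IsPos X u) ↔
        μ = (l₀ : ℂ)) := by
  open StrongProjections in
  have h12 : IsPosOp X (spectralProjection A (l₀ : ℂ)) ∧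
      IsIrreducibleOp X (spectralProjection A (l₀ : ℂ)) →
      IsStronglyPosOp X (spectralProjection A (l₀ : ℂ)) := fun h =>
    h.2.isStronglyPosOp h.1 (spectralProjection_idem hA_closed hl_pole)
      (spectralProjection_ne_zero hl_pole hl_eig)
  refine ⟨?_, ?_⟩
  · tfae_have 1 → 2 := h12
    tfae_have 2 → 1 := fun h => ⟨h.isPosOp, h.isIrreducibleOp⟩
    tfae_have 2 → 3 := by
      intro h
      obtain ⟨u, φ, hu, huq, hu0, hφ, hform⟩ := h.exists_eigenvector hA_closed hl_pole hl_eig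
      exact ⟨StrongProjections.isGeometricallySimple_of_stronglyPos hl_pole hu hu0 hform,
        ⟨u, hu, huq⟩, φ, StrongProjections.functional_mem_eigenspace hA_closed
          hA_dense hl_pole hu hu0 hform, hφ⟩
    tfae_have 3 → 4 := by
      rintro ⟨hgeo, ⟨u, hu, huq⟩, φ, hφ, hφpos⟩
      obtain ⟨w, -, hw0⟩ := (Submodule.ne_bot_iff _).1 hl_eig
      have hu0 : u ≠ 0 := huq.ne_zero hw0
      refine ⟨⟨hl_eig, ?_⟩, ⟨u, hu, huq⟩,
        StrongProjections.shiftRange_inter_posCone hA_dense hφ hφpos⟩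
      rw [StrongProjections.genEigenspace_eq_eigenspace hA_dense hgeo hu hu0 hφ
        (hφpos.apply_ne_zero huq.isPos hu0)]
      exact hgeo
    tfae_have 4 → 2 := by
      rintro ⟨halg, ⟨u, hu, huq⟩, hrange⟩
      exact StrongProjections.isStronglyPosOp_of_algebraicallySimple hA_closed hA_real hl_pole
        halg hu huq hrange
    tfae_finish
  · intro h
    obtain ⟨u, φ, hu, huq, hu0, hφ, hform⟩ :=
      (h12 h).exists_eigenvector hA_closed hl_pole hl_eig
    have hφeig := StrongProjections.functional_mem_eigenspace hA_closed hA_dense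
      hl_pole hu hu0 hform
    have hφu : φ u ≠ 0 := hφ.apply_ne_zero huq.isPos hu0
    have hφ0 : φ ≠ 0 := by
      rintro rfl
      exact hφu rfl
    obtain ⟨g, hg, hgP⟩ := StrongProjections.exists_isLaurent_one hA_closed hl_pole fun z => by
      rw [hform]
      exact Submodule.smul_mem _ _ hu
    refine ⟨StrongProjections.isSimpleResolventPole_of_isLaurent hg ?_ hl_pole.1,
      StrongProjections.isSimpleResolventPole_of_isLaurent (hg.adjointL hA_dense) ?_
        (StrongProjections.mem_opSpectrum_of_mem_eigenspace hφeig hφ0), fun μ => ⟨?_, ?_⟩⟩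
    · rw [hgP]
      exact StrongProjections.spectralProjection_ne_zero hl_pole hl_eig
    -- The leading coefficient for $A'$ is $P'$, and $(P'\varphi)(u) = \varphi(Pu) = \varphi(u)\ne
    -- 0$.
    · intro h0
      apply hφu
      have h1 := congrArg (fun T => T φ u) h0
      simp only [StrongProjections.adjointL_apply, hgP] at h1
      rwa [StrongProjections.spectralProjection_apply_of_mem_eigenspace hl_pole hu] at h1
    -- For $Af=\mu f$ the vector $(\lambda_0-A)f = (\lambda_0-\mu)f$ is annihilated by $\varphi$,
    -- while $\varphi(f)\ne 0$ for $f>0$.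
    · rintro ⟨f, hf, hf0, hfpos⟩
      have h1 := StrongProjections.shiftGraph_change (μ := (l₀ : ℂ))
        (StrongProjections.mem_eigenspace_iff.1 hf)
      have h2 := (StrongProjections.mem_eigenspace_dualOp_iff hA_dense).1 hφeig _
        (StrongProjections.mem_shiftRange_iff.2 ⟨f, h1⟩)
      rw [zero_sub, map_neg, map_smul, neg_eq_zero, smul_eq_mul] at h2
      exact sub_eq_zero.1 ((mul_eq_zero.1 h2).resolve_right (hφ.apply_ne_zero hfpos hf0))
    · rintro rfl
      exact ⟨u, hu, hu0, huq.isPos⟩
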